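/- **Conventions.** Fix a positive integer $n$; vector spaces are over $\mathbf C$; $\mathbf x=(x_1,\dots,x_n)$, and similarly $\mathbf y,\mathbf z$; write $\mathbf x^{\mathbf m}=\prod_i x_i^{m_i}$ and $(\mathbf x-\mathbf y)^{\mathbf m}=\prod_i (x_i-y_i)^{m_i}$ for $\mathbf m\in\mathbf Z^n$, and $(\mathbf x-\mathbf y)^k=\prod_i(x_i-y_i)^k$ for $k\in\mathbf Z$. A power $(x-y)^m$ is expanded in nonnegative powers of $y$, and $(-y+x)^m$ in nonnegative powers of $x$. Also $\mathbf z^{-1}\delta\left(\frac{\mathbf x-\mathbf y}{\mathbf z}\right)=\sum_{\mathbf m\in\mathbf Z^n}\mathbf z^{-\mathbf m-1}(\mathbf x-\mathbf y)^{\mathbf m}$, where $\mathbf z^{-\mathbf m-1}=\prod_i z_i^{-m_i-1}$, and $U((\mathbf x))=U[[\mathbf x]][x_1^{-1},\dots,x_n^{-1}]$. A *$G_n$-vertex operator* on $W$ is a series $\psi(\mathbf x)\in(\mathrm{End}\,W)[[x_1^{\pm1},\dots,x_n^{\pm1}]]$ with $\psi(\mathbf x)w\in W((\mathbf x))$ for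 all $w\in W$. Two such operators $\psi,\phi$ are *mutually local* if $(\mathbf x-\mathbf y)^k\psi(\mathbf x)\phi(\mathbf y)=(\mathbf x-\mathbf y)^k\phi(\mathbf y)\psi(\mathbf x)$ for some $k\in\mathbf N$. A set of $G_n$-vertex operators is *local* if any two of its members (possibly equal) are mutually local. For $\alpha\in\{0,1\}^n$ let $|\alpha|=\sum_i\alpha_i$, and let $\iota_{\alpha}((\mathbf x-\mathbf y)^{\mathbf m})$ be the product over $i$ of $(x_i-y_i)^{m_i}$ if $\alpha_i=0$ and of $(-y_i+x_i)^{m_i}$ if $\alpha_i=1$. If $f(\mathbf x,\mathbf y)$ is an $\mathrm{End}\,W$-valued series such that $(\mathbf x-\mathbf y)^kf\in\mathrm{Hom}(W,W((\mathbf x,\mathbf y)))$ for some $k\in\mathbf N$, put $\iota_\alpha(f)=\iota_\alpha((\mathbf x-\mathbf y)^{-k})\left((\mathbf x-\mathbf y)^kf\right)$, which does not depend on $k$; $\iota_\alpha$ is extended coefficientwise to series in $\mathbf z$ with such coefficients. For mutually local $\psi,\phi$ and $\mathbf m\in\mathbf Z^n$ let $$(\psi_{\mathbf m}\phi)(\mathbf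 y)=\sum_{\alpha}(-1)^{|\alpha|}\,\mathrm{Res}_{\mathbf x}\,\iota_{\alpha}\left((\mathbf x-\mathbf y)^{\mathbf m}\psi(\mathbf x)\phi(\mathbf y)\right),$$ where $\mathrm{Res}_{\mathbf x}$ takes the coefficient of $x_1^{-1}\cdots x_n^{-1}$. A local subspace $V$ of the space of $G_n$-vertex operators on $W$ is *closed* if $\psi_{\mathbf m}\phi\in V$ for all $\psi,\phi\in V$ and $\mathbf m\in\mathbf Z^n$. A *$G_n$-vertex algebra* is a vector space $V$ with a linear map $u\mapsto Y(u,\mathbf x)$ from $V$ to the $G_n$-vertex operators on $V$ and a vector $\mathbf 1\in V$ such that: $Y(\mathbf 1,\mathbf x)=1$; $Y(v,\mathbf x)\mathbf 1\in V[[\mathbf x]]$ has constant term $v$, for all $v$; $Y(u,\mathbf x)$ and $Y(v,\mathbf x)$ are mutually local for all $u,v$; and, for all $u,v\in V$, $$\mathbf y^{-1}\delta\left(\tfrac{\mathbf x-\mathbf z}{\mathbf y}\right)Y(Y(u,\mathbf z)v,\mathbf y)=\sum_{\alpha}(-1)^{|\alpha|}\iota_{\alpha}\left(\mathbf z^{-1}\delta\left(\tfrac{\mathbf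 x-\mathbf y}{\mathbf z}\right)Y(u,\mathbf x)Y(v,\mathbf y)\right).$$ A *module* for $V$ is a vector space $W$ with a linear map $u\mapsto Y_W(u,\mathbf x)$ from $V$ to the $G_n$-vertex operators on $W$ such that $Y_W(\mathbf 1,\mathbf x)=1$, any $Y_W(u,\mathbf x)$, $Y_W(v,\mathbf x)$ are mutually local, and $\mathbf y^{-1}\delta\left(\frac{\mathbf x-\mathbf z}{\mathbf y}\right)Y_W(Y(u,\mathbf z)v,\mathbf y)=\sum_{\alpha}(-1)^{|\alpha|}\iota_{\alpha}\left(\mathbf z^{-1}\delta\left(\frac{\mathbf x-\mathbf y}{\mathbf z}\right)Y_W(u,\mathbf x)Y_W(v,\mathbf y)\right)$ for all $u,v\in V$. **Theorem.** Let $W$ be a vector space and let $S$ be any local set of $G_n$-vertex operators on $W$. Then, among the closed local subspaces of the space of $G_n$-vertex operators on $W$ that contain $S$ and the identity operator $1$ of $W$, there is a smallest one, $\langle S\rangle$. It is a $G_n$-vertex algebra with vacuum vector $1$ and $$Y(\psi,\mathbf z)\phi=\sum_{\mathbf m\in\mathbf Z^n}(\psi_{\mathbf m}\phi)\,\mathbf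 z^{-\mathbf m-1}\qquad(\psi,\phi\in\langle S\rangle),$$ and $W$ is a module for $\langle S\rangle$ with $Y_W(\psi,\mathbf x)=\psi(\mathbf x)$ for $\psi\in\langle S\rangle$. -/

import Mathlib

noncomputable section

open scoped Classical in
/-- The sum of a family of endomorphisms of `W`. It exists (algebraically) when, for every vector
`w`, only finitely many members of the family do not kill `w`. The value is `0` otherwise. -/
def opSum {ι W : Type*} [AddCommGroup W] [Module ℂ W] (F : ι → Module.End ℂ W) :
    Module.End ℂ W :=
  if h : ∀ w, (Function.support fun i => F i w).Finite then
    { toFun := fun w => ∑ᶠ i, F i w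
      map_add' := fun v w => by
        simp only [map_add]
        exact finsum_add_distrib (h v) (h w)
      map_smul' := fun c w => by
        simp only [map_smul, RingHom.id_apply]
        exact (smul_finsum' c (h w)).symm }
  else 0

/-- `(End W)[[x₁, x₁⁻¹, …, xₙ, xₙ⁻¹]]`: the value of `ψ` at `m` is the coefficient of `x ^ m`. -/
abbrev OpSeries (n : ℕ) (W : Type*) [AddCommGroup W] [Module ℂ W] : Type _ :=
  (Fin n → ℤ) → Module.End ℂ W

/-- `(End W)[[xᵢ, xᵢ⁻¹, yᵢ, yᵢ⁻¹ | 1 ≤ i ≤ n]]`: the value of `f` at `a`, `b` is the coefficient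
of `x ^ a y ^ b`. -/
abbrev OpSeries₂ (n : ℕ) (W : Type*) [AddCommGroup W] [Module ℂ W] : Type _ :=
  (Fin n → ℤ) → (Fin n → ℤ) → Module.End ℂ W

/-- `f ∈ W((x₁, …, xₙ)) = W[[x₁, …, xₙ]][x₁⁻¹, …, xₙ⁻¹]`: the exponents of all the variables
that occur in `f` are bounded below. -/
def LowerTruncated {n : ℕ} {W : Type*} [Zero W] (f : (Fin n → ℤ) → W) : Prop :=
  ∃ N : ℤ, ∀ m : Fin n → ℤ, (∃ i, m i < N) → f m = 0

/-- `f ∈ W((x, y)) = W((x₁, …, xₙ, y₁, …, yₙ))`. -/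
def LowerTruncated₂ {n : ℕ} {W : Type*} [Zero W] (f : (Fin n → ℤ) → (Fin n → ℤ) → W) : Prop :=
  ∃ N : ℤ, ∀ a b : Fin n → ℤ, (∃ i, a i < N ∨ b i < N) → f a b = 0

/-- The space of `Gₙ`-vertex operators on `W`: the series `ψ(x)` with `ψ(x) w ∈ W((x))` for every
`w`. -/
def VO (n : ℕ) (W : Type*) [AddCommGroup W] [Module ℂ W] : Submodule ℂ (OpSeries n W) where
  carrier := {ψ | ∀ w : W, LowerTruncated fun m => ψ m w}
  add_mem' := by
    intro ψ φ hψ hφ w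
    obtain ⟨N, hN⟩ := hψ w
    obtain ⟨M, hM⟩ := hφ w
    refine ⟨min N M, fun m ⟨i, hi⟩ => ?_⟩
    have h1 := hN m ⟨i, lt_of_lt_of_le hi (min_le_left _ _)⟩
    have h2 := hM m ⟨i, lt_of_lt_of_le hi (min_le_right _ _)⟩
    simp only at h1 h2
    simp [h1, h2]
  zero_mem' := fun w => ⟨0, fun m _ => by simp⟩
  smul_mem' := by
    intro c ψ hψ w
    obtain ⟨N, hN⟩ := hψ w
    refine ⟨N, fun m hm => ?_⟩
    have h1 := hN m hm
    simp only at h1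
    simp [h1]

/-- The identity operator `1` of `W`, as a constant series. -/
def idOp (n : ℕ) (W : Type*) [AddCommGroup W] [Module ℂ W] : OpSeries n W :=
  Pi.single 0 1

/-- The coefficient of `x ^ p y ^ q` (one variable `x`, one variable `y`) in the expansion of
`(x - y) ^ m` in nonnegative powers of `y` if `s = 0`, i.e. `(x - y) ^ m`, and in nonnegative
powers of `x` if `s = 1`, i.e. `(-y + x) ^ m`. -/
def expCoeff (s : ZMod 2) (m p q : ℤ) : ℂ :=
  if p + q = m then
    if s = 0 then
      if 0 ≤ q then (Ring.choose m q.toNat : ℂ) * (-1) ^ q else 0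
    else
      if 0 ≤ p then (Ring.choose m p.toNat : ℂ) * (-1) ^ q else 0
  else 0

/-- The scalar series `ι_α((x - y) ^ m) = ∏ᵢ ι_α((xᵢ - yᵢ) ^ mᵢ)` for `α ∈ (F₂)ⁿ` and `m ∈ ℤⁿ`.
For `α = 0` it is the series that is denoted by `(x - y) ^ m` itself. -/
def iotaPow {n : ℕ} (α : Fin n → ZMod 2) (m a b : Fin n → ℤ) : ℂ :=
  ∏ i, expCoeff (α i) (m i) (a i) (b i)

/-- The product of a scalar series and an operator valued series in `x`, `y`. -/
def mulSeries {n : ℕ} {W : Type*} [AddCommGroup W] [Module ℂ W]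
    (c : (Fin n → ℤ) → (Fin n → ℤ) → ℂ) (f : OpSeries₂ n W) : OpSeries₂ n W :=
  fun a b => opSum fun r : (Fin n → ℤ) × (Fin n → ℤ) => c r.1 r.2 • f (a - r.1) (b - r.2)

/-- `(x - y) ^ k f(x, y)` for `k ∈ ℤ`, where `(x - y) ^ k = ∏ᵢ (xᵢ - yᵢ) ^ k`. -/
def mulPow {n : ℕ} {W : Type*} [AddCommGroup W] [Module ℂ W] (k : ℤ) (f : OpSeries₂ n W) :
    OpSeries₂ n W :=
  mulSeries (iotaPow 0 fun _ => k) f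

/-- The product `ψ(x) φ(y)`. -/
def prodXY {n : ℕ} {W : Type*} [AddCommGroup W] [Module ℂ W] (ψ φ : OpSeries n W) :
    OpSeries₂ n W :=
  fun a b => ψ a * φ b

/-- The product `φ(y) ψ(x)`. -/
def prodYX {n : ℕ} {W : Type*} [AddCommGroup W] [Module ℂ W] (ψ φ : OpSeries n W) :
    OpSeries₂ n W :=
  fun a b => φ b * ψ a

/-- Mutual locality: `(x - y) ^ k ψ(x) φ(y) = (x - y) ^ k φ(y) ψ(x)` for some `k ∈ ℕ`. -/
def MutuallyLocal {n : ℕ} {W : Type*} [AddCommGroup W] [Module ℂ W] (ψ φ : OpSeries n W) : Prop :=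
  ∃ k : ℕ, mulPow k (prodXY ψ φ) = mulPow k (prodYX ψ φ)

/-- A local set of `Gₙ`-vertex operators: any two members, distinct or not, are mutually local. -/
def IsLocalSet {n : ℕ} {W : Type*} [AddCommGroup W] [Module ℂ W] (S : Set (OpSeries n W)) : Prop :=
  S ⊆ VO n W ∧ ∀ ψ ∈ S, ∀ φ ∈ S, MutuallyLocal ψ φ

/-- `k` clears the denominators of `f`: `(x - y) ^ k f(x, y) ∈ Hom(W, W((x, y)))`. The series `f`
for which such a `k ∈ ℕ` exists form the space `R(W, x, y)`. -/
def Clears {n : ℕ} {W : Type*} [AddCommGroup W] [Module ℂ W] (k : ℕ) (f : OpSeries₂ n W) : Prop :=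
  ∀ w : W, LowerTruncated₂ fun a b => mulPow k f a b w

open scoped Classical in
/-- The map `ι_α` on `R(W, x, y)`: `ι_α(f) = ι_α((x - y) ^ (-k)) ((x - y) ^ k f)`, where `k ∈ ℕ`
is such that `(x - y) ^ k f ∈ Hom(W, W((x, y)))` (the result does not depend on that `k`).
The value outside of `R(W, x, y)` is `0`. -/
def iota {n : ℕ} {W : Type*} [AddCommGroup W] [Module ℂ W] (α : Fin n → ZMod 2)
    (f : OpSeries₂ n W) : OpSeries₂ n W :=
  if h : ∃ k : ℕ, Clears k f then
    mulSeries (iotaPow α fun _ => -(h.choose : ℤ)) (mulPow h.choose f)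
  else 0

/-- `∑_α (-1) ^ |α| ι_α((x - y) ^ m ψ(x) φ(y))`, the sum over `α ∈ (F₂)ⁿ`, where `|α|` is the
number of nonzero coordinates of `α`. -/
def iotaSum {n : ℕ} {W : Type*} [AddCommGroup W] [Module ℂ W] (m : Fin n → ℤ)
    (ψ φ : OpSeries n W) : OpSeries₂ n W :=
  ∑ α : Fin n → ZMod 2,
    (-1 : ℂ) ^ hammingNorm α • iota α (mulSeries (iotaPow 0 m) (prodXY ψ φ))

/-- The `m`-th product `(ψ_m φ)(y) = ∑_α (-1) ^ |α| Res_x ι_α((x - y) ^ m ψ(x) φ(y))`. -/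
def nthProd {n : ℕ} {W : Type*} [AddCommGroup W] [Module ℂ W] (m : Fin n → ℤ)
    (ψ φ : OpSeries n W) : OpSeries n W :=
  fun b => iotaSum m ψ φ (fun _ => -1) b

/-- Closed local subspaces of the space of `Gₙ`-vertex operators on `W`. -/
def IsClosedLocal {n : ℕ} {W : Type*} [AddCommGroup W] [Module ℂ W]
    (V : Submodule ℂ (OpSeries n W)) : Prop :=
  IsLocalSet (V : Set (OpSeries n W)) ∧ ∀ ψ ∈ V, ∀ φ ∈ V, ∀ m : Fin n → ℤ, nthProd m ψ φ ∈ V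

/-- `⟨S⟩`: the intersection of all closed local subspaces that contain `S` and `1`. -/
def generatedBy {n : ℕ} {W : Type*} [AddCommGroup W] [Module ℂ W] (S : Set (OpSeries n W)) :
    Submodule ℂ (OpSeries n W) :=
  sInf {V | IsClosedLocal V ∧ S ⊆ V ∧ idOp n W ∈ V}

/-- The coefficient of `x ^ a y ^ b z ^ c` in
`y⁻¹ δ((x - z) / y) = ∑_{r ∈ ℤⁿ} y ^ (-r - 1) (x - z) ^ r`,
where `(x - z) ^ r` is expanded in nonnegative powers of `z`. -/
def deltaCoeff {n : ℕ} (a b c : Fin n → ℤ) : ℂ :=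
  iotaPow 0 (fun i => -b i - 1) a c

/-- The Jacobi identity on `W` (with `W = V` and `Y_W = Y` for an algebra), for all `u`, `v`:
`y⁻¹ δ((x - z) / y) Y_W(Y(u, z) v, y)
  = ∑_α (-1) ^ |α| ι_α(z⁻¹ δ((x - y) / z) Y_W(u, x) Y_W(v, y))`,
as an equality of the coefficients of `x ^ a y ^ b z ^ c`. On the right,
`z⁻¹ δ((x - y) / z) = ∑_m z ^ (-m - 1) (x - y) ^ m`. -/
def JacobiIdentity {n : ℕ} {V W : Type*} [AddCommGroup V] [Module ℂ V] [AddCommGroup W]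
    [Module ℂ W] (Y : V →ₗ[ℂ] OpSeries n V) (YW : V →ₗ[ℂ] OpSeries n W) : Prop :=
  ∀ (u v : V) (a b c : Fin n → ℤ),
    (opSum fun r : (Fin n → ℤ) × (Fin n → ℤ) =>
        deltaCoeff a r.1 r.2 • YW (Y u (c - r.2) v) (b - r.1)) =
      iotaSum (fun i => -c i - 1) (YW u) (YW v) a b

/-- `Gₙ`-vertex algebra structures on a vector space `V`. The operator `u_m` is the coefficient of
`x ^ (-m - 1)` in `Y(u, x)`. -/
structure GnVertexAlgebra (n : ℕ) (V : Type*) [AddCommGroup V] [Module ℂ V] where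
  /-- The vertex operator map. -/
  Y : V →ₗ[ℂ] OpSeries n V
  /-- The vacuum vector. -/
  vac : V
  truncated : ∀ u, Y u ∈ VO n V
  Y_vac : Y vac = idOp n V
  creation_regular : ∀ (v : V) (m : Fin n → ℤ), (∃ i, m i < 0) → Y v m vac = 0
  creation_limit : ∀ v : V, Y v 0 vac = v
  weak_commutativity : ∀ u v, MutuallyLocal (Y u) (Y v)
  jacobi : JacobiIdentity Y Y

/-- Structures of a module on a vector space `W` for a `Gₙ`-vertex algebra `A`. -/
structure GnModule {n : ℕ} {V : Type*} [AddCommGroup V] [Module ℂ V] (A : GnVertexAlgebra n V)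
    (W : Type*) [AddCommGroup W] [Module ℂ W] where
  /-- The action of the algebra by vertex operators on `W`. -/
  YW : V →ₗ[ℂ] OpSeries n W
  truncated : ∀ u, YW u ∈ VO n W
  Y_vac : YW A.vac = idOp n W
  weak_commutativity : ∀ u v, MutuallyLocal (YW u) (YW v)
  jacobi : JacobiIdentity A.Y YW

end

set_option linter.unusedSectionVars false

open Function

/-! Let `ψ`, `φ` be mutually local and f(x, y) = ψ(x)φ(y)w. One order of the product is truncated in
y, the other in x, and they agree after multiplication by finitely many factors xᵢ - yᵢ. So f is in
W((x, y)) up to poles along xᵢ = yᵢ whose orders are bounded independently of w. The alternating sum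
of the expansions of (x - y)^(-k) is a product of derivatives of delta functions, and pairing it
with a series without poles gives a Taylor coefficient on the diagonal. Hence (ψ_m φ)(y)w is the
coefficient of z^(-m-1) in f(y + z, y) (`iotaSum_apply`, `nthProd_apply`): Y(ψ, z)φ is "ψ(y +
z)φ(y)". This expansion is `diagExp`; under it xᵢ - yᵢ becomes zᵢ and xᵢ becomes yᵢ + zᵢ.

Existence of ⟨S⟩: by Dong's lemma (`MutuallyLocal.nthProd`) an m-th product is local with everything
that is local with both of its factors. By maximality a maximal local set containing S is then a
closed subspace containing 1, and ⟨S⟩ is an intersection that lies inside it.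

Jacobi identity: the delta function on its left side is the binomial expansion of (y + z)^(-a-1),
which is also what x^(-a-1) becomes on the right. So the identity follows from locality and the
formula Y_W(Y(u, z)v, y) = "Y_W(u, y + z)Y_W(v, y)" (`jacobiIdentity_of_apply_apply`). On W this
formula is the description of the m-th products. On ⟨S⟩ let F = u(x₁)v(x₂)w(y) applied to a vector.
Then Y(u, z₁)Y(v, z₂)w is F at x₁ = y + z₁, x₂ = y + z₂ (`nestedExp`), and Y(Y(u, z₁)v, z₂)w is F at
x₁ = x₂ + z₁, x₂ = y + z₂ (`iterExp`). If F has no poles, these are finite sums: commutativity is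
their symmetry, and associativity is Vandermonde's identity. In general F has poles along the three
diagonals; they are put back one factor at a time, each factor acting on the expansions by a
multiplication that can be cancelled. -/

section

/-! ### Binomial coefficients with integer arguments -/

/-- The binomial coefficient of two integers, which is `0` when the lower one is negative. -/
noncomputable def binom (a j : ℤ) : ℂ := if 0 ≤ j then (Ring.choose a j.toNat : ℂ) else 0

lemma binom_natCast (a : ℤ) (j : ℕ) : binom a j = (Ring.choose a j : ℂ) := by
  simp [binom]

lemma binom_of_neg (a : ℤ) {j : ℤ} (hj : j < 0) : binom a j = 0 := by
  simp [binom, not_le.2 hj]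

lemma binom_zero_right (a : ℤ) : binom a 0 = 1 := by
  simp [binom]

lemma binom_zero_left (j : ℤ) : binom 0 j = if j = 0 then 1 else 0 := by
  rcases lt_or_ge j 0 with hj | hj
  · simp [binom_of_neg _ hj, hj.ne]
  · lift j to ℕ using hj
    simp [binom_natCast, Ring.choose_zero_ite]

/-- The value 0 at negative lower index makes Pascal's rule hold without exception at `j = 0`. -/
lemma binom_succ (a j : ℤ) : binom (a + 1) j = binom a j + binom a (j - 1) := by
  rcases lt_or_ge j 0 with hj | hj
  · simp [binom_of_neg _ hj, binom_of_neg _ (show j - 1 < 0 by lia)]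
  · lift j to ℕ using hj
    cases j with
    | zero => simp [binom_zero_right, binom_of_neg]
    | succ j =>
      rw [show ((j + 1 : ℕ) : ℤ) - 1 = (j : ℕ) by simp, binom_natCast, binom_natCast, binom_natCast,
        Int.cast_add, Int.cast_one, Ring.choose_succ_succ, add_comm]

lemma binom_neg (a : ℤ) (j : ℕ) : binom (-a) j = (-1) ^ j * binom (a + j - 1) j := by
  rw [binom_natCast, binom_natCast, Int.cast_neg, Ring.choose_neg]
  rw [Int.negOnePow_def, Units.smul_def]
  simp

lemma binom_eq_zero_of_lt {a j : ℤ} (ha : 0 ≤ a) (h : a < j) : binom a j = 0 := by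
  lift a to ℕ using ha
  lift j to ℕ using (by lia)
  rw [binom_natCast, Int.cast_natCast, Ring.choose_natCast, Nat.choose_eq_zero_of_lt (by lia)]
  simp

lemma binom_symm {a j : ℤ} (ha : 0 ≤ a) : binom a (a - j) = binom a j := by
  rcases lt_or_ge j 0 with hj | hj
  · rw [binom_of_neg _ hj, binom_eq_zero_of_lt ha (by lia)]
  rcases lt_or_ge a j with h | h
  · rw [binom_of_neg _ (by lia), binom_eq_zero_of_lt ha h]
  lift a to ℕ using ha
  lift j to ℕ using hj
  rw [show (a : ℤ) - j = ((a - j : ℕ) : ℤ) by lia, binom_natCast, binom_natCast,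
    Int.cast_natCast, Ring.choose_natCast, Ring.choose_natCast, Nat.choose_symm (by lia)]

lemma binom_add (a b c : ℤ) :
    binom (a + b) c = ∑ r ∈ Finset.Icc 0 c, binom b r * binom a (c - r) := by
  rcases lt_or_ge c 0 with hc | hc
  · simp [binom_of_neg _ hc, hc]
  · lift c to ℕ using hc
    rw [binom_natCast, add_comm, Int.cast_add, Ring.add_choose_eq c (Commute.all (b : ℂ) a)]
    refine Finset.sum_bij (fun ij _ => (ij.1 : ℤ)) ?_ ?_ ?_ ?_
    · intro ij h
      rw [Finset.HasAntidiagonal.mem_antidiagonal] at h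
      rw [Finset.mem_Icc]
      lia
    · intro ij h ij' h' e
      rw [Finset.HasAntidiagonal.mem_antidiagonal] at h h'
      ext <;> lia
    · intro r hr
      rw [Finset.mem_Icc] at hr
      refine ⟨(r.toNat, c - r.toNat), ?_, ?_⟩
      · rw [Finset.HasAntidiagonal.mem_antidiagonal]
        simp only
        lia
      · simp [hr.1]
    · intro ij h
      rw [Finset.HasAntidiagonal.mem_antidiagonal] at h
      rw [show (c : ℤ) - ij.1 = (ij.2 : ℕ) by lia, binom_natCast, binom_natCast]

lemma binom_mul_binom (a e c : ℤ) :
    binom a e * binom e c = binom a c * binom (a - c) (e - c) := by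
  rcases lt_or_ge c 0 with hc | hc
  · simp [binom_of_neg _ hc]
  rcases lt_or_ge e c with h | h
  · rw [binom_of_neg (a - c) (by lia : e - c < 0)]
    rcases lt_or_ge e 0 with he | he
    · simp [binom_of_neg _ he]
    · simp [binom_eq_zero_of_lt he h]
  lift c to ℕ using hc
  lift e to ℕ using (by lia)
  have h' : c ≤ e := by lia
  rw [show (e : ℤ) - c = (e - c : ℕ) by lia]
  simp only [binom_natCast]
  have := Ring.choose_smul_choose (a : ℂ) h'
  rw [nsmul_eq_mul] at this
  rw [Int.cast_natCast, Ring.choose_natCast, mul_comm, this, Int.cast_sub, Int.cast_natCast]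

variable {n : ℕ}

/-- The product of the binomial coefficients of the coordinates. -/
noncomputable def multiBinom (a j : Fin n → ℤ) : ℂ := ∏ i, binom (a i) (j i)

lemma multiBinom_of_neg (a : Fin n → ℤ) {j : Fin n → ℤ} {i : Fin n} (hj : j i < 0) :
    multiBinom a j = 0 :=
  Finset.prod_eq_zero (Finset.mem_univ i) (binom_of_neg _ hj)

lemma multiBinom_zero_right (a : Fin n → ℤ) : multiBinom a 0 = 1 := by
  simp [multiBinom, binom_zero_right]

lemma multiBinom_zero_left (j : Fin n → ℤ) : multiBinom 0 j = if j = 0 then 1 else 0 := by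
  simp only [multiBinom, Pi.zero_apply, binom_zero_left]
  split_ifs with h
  · simp [h]
  · obtain ⟨i, hi⟩ := Function.ne_iff.1 h
    exact Finset.prod_eq_zero (Finset.mem_univ i) (if_neg hi)

/-- The `i`-th unit vector of `ℤⁿ`. -/
abbrev unitVec (i : Fin n) : Fin n → ℤ := Pi.single i 1

lemma multiBinom_succ (a j : Fin n → ℤ) (i : Fin n) :
    multiBinom (a + unitVec i) j = multiBinom a j + multiBinom a (j - unitVec i) := by
  refine (Finset.prod_add_prod_eq (Finset.mem_univ i) ?_ ?_ ?_).symm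
  · simp [binom_succ]
  · intro k _ hk
    simp [hk]
  · intro k _ hk
    simp [hk]

lemma multiBinom_add (a b c : Fin n → ℤ) :
    multiBinom (a + b) c = ∑ r ∈ Finset.Icc 0 c, multiBinom b r * multiBinom a (c - r) := by
  simp only [multiBinom, Pi.add_apply, binom_add, Finset.prod_univ_sum, ← Finset.prod_mul_distrib,
    Pi.Icc_eq]
  rfl

lemma multiBinom_mul_multiBinom (a e c : Fin n → ℤ) :
    multiBinom a e * multiBinom e c = multiBinom a c * multiBinom (a - c) (e - c) := by
  simp [multiBinom, ← Finset.prod_mul_distrib, binom_mul_binom]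

/-! ### Expansions of powers of `x - y` -/

lemma expCoeff_of_ne (s : ZMod 2) {m p q : ℤ} (h : p + q ≠ m) : expCoeff s m p q = 0 := by
  simp [expCoeff, h]

lemma expCoeff_zero_eq (m q : ℤ) : expCoeff 0 m (m - q) q = binom m q * (-1) ^ q := by
  simp [expCoeff, binom]

lemma expCoeff_one_eq (m p : ℤ) : expCoeff 1 m p (m - p) = binom m p * (-1) ^ (m - p) := by
  simp [expCoeff, binom]

lemma expCoeff_succ (s : ZMod 2) (m p q : ℤ) :
    expCoeff s (m + 1) p q = expCoeff s m (p - 1) q - expCoeff s m p (q - 1) := by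
  by_cases h : p + q = m + 1
  · obtain rfl | rfl : s = 0 ∨ s = 1 := by revert s; decide
    · obtain rfl : p = m + 1 - q := by lia
      rw [expCoeff_zero_eq, show m + 1 - q - 1 = m - q by ring, expCoeff_zero_eq,
        show m + 1 - q = m - (q - 1) by ring, expCoeff_zero_eq, binom_succ,
        zpow_sub_one₀ (by norm_num)]
      norm_num
      ring
    · obtain rfl : q = m + 1 - p := by lia
      rw [expCoeff_one_eq, show m + 1 - p = m - (p - 1) by ring, expCoeff_one_eq,
        show m - (p - 1) - 1 = m - p by ring, expCoeff_one_eq, binom_succ,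
        show m - (p - 1) = (m - p) + 1 by ring, zpow_add_one₀ (by norm_num)]
      ring
  · rw [expCoeff_of_ne s h, expCoeff_of_ne s (by lia), expCoeff_of_ne s (by lia), sub_zero]

/-- The expansions of `(x - y) ^ (-k)` in the two domains differ by a derivative of the delta
function. -/
lemma expCoeff_zero_sub_expCoeff_one (k : ℕ) (p q : ℤ) :
    expCoeff 0 (-k) p q - expCoeff 1 (-k) p q =
      if p + q = -k then binom (-p - 1) (k - 1) else 0 := by
  split_ifs with h
  swap
  · rw [expCoeff_of_ne _ h, expCoeff_of_ne _ h, sub_zero]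
  obtain rfl : q = -k - p := by lia
  have h₀ := expCoeff_zero_eq (-k) (-k - p)
  rw [sub_sub_cancel] at h₀
  rw [h₀, expCoeff_one_eq, ← sub_mul]
  rcases Nat.eq_zero_or_pos k with rfl | hk
  -- For `k = 0` both expansions are 1, and the right side has lower index -1.
  · simp [binom_zero_left, binom_of_neg]
  -- Upper negation followed by symmetry; symmetry needs `k - 1 + q ≥ 0`, hence `k > 0`.
  have key (q : ℤ) : binom (-k) q * (-1) ^ q =
      if 0 ≤ q then binom (k - 1 + q) (k - 1) else 0 := by
    split_ifs with hq
    swap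
    · rw [binom_of_neg _ (by lia), zero_mul]
    lift q to ℕ using hq
    rw [binom_neg, zpow_natCast, mul_right_comm, ← mul_pow, show (k : ℤ) + q - 1 = k - 1 + q by ring,
      ← binom_symm (j := (k : ℤ) - 1) (by lia)]
    simp
  have hneg : binom (-p - 1) (k - 1) = -((-1) ^ k * binom (k - 1 + p) (k - 1)) := by
    obtain ⟨k, rfl⟩ := Nat.exists_eq_add_of_le' hk
    rw [show (((k + 1 : ℕ) : ℤ) - 1) = k by simp, show -p - 1 = -(p + 1) by ring, binom_neg,
      pow_succ, show p + 1 + k - 1 = k + p by ring]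
    ring
  have hsign : (-1 : ℂ) ^ (-k - p) = (-1) ^ k * (-1) ^ p := by
    rw [zpow_sub₀ (by norm_num), zpow_neg, zpow_natCast, ← inv_pow, div_eq_mul_inv, ← inv_zpow]
    norm_num
  rw [sub_mul, key, hsign, mul_left_comm, key]
  -- The two supports are disjoint because `k > 0`. In the gap `-k < p < 0` between them the right
  -- side vanishes as well, since `0 ≤ -p - 1 < k - 1`.
  split_ifs with h₁ h₂ h₂
  · lia
  · rw [show (k : ℤ) - 1 + (-k - p) = -p - 1 by ring]
    simp
  · rw [hneg]
    simp
  · rw [binom_eq_zero_of_lt (by lia) (by lia)]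
    simp

/-- Pascal's rule in the `i`-th coordinate only. It is the same for every `α`: each expansion
respects multiplication by xᵢ - yᵢ. -/
lemma iotaPow_succ (α : Fin n → ZMod 2) (m a b : Fin n → ℤ) (i : Fin n) :
    iotaPow α (m + unitVec i) a b =
      iotaPow α m (a - unitVec i) b - iotaPow α m a (b - unitVec i) := by
  rw [eq_sub_iff_add_eq]
  refine Finset.prod_add_prod_eq (Finset.mem_univ i) ?_ ?_ ?_
  · simp [expCoeff_succ]
  · intro k _ hk
    simp [hk]
  · intro k _ hk
    simp [hk]

lemma add_eq_of_iotaPow_ne_zero {α : Fin n → ZMod 2} {m a b : Fin n → ℤ}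
    (h : iotaPow α m a b ≠ 0) : a + b = m := by
  ext i
  by_contra hi
  exact h (Finset.prod_eq_zero (Finset.mem_univ i) (expCoeff_of_ne _ hi))

lemma nonneg_of_iotaPow_zero_ne_zero {m a b : Fin n → ℤ} (h : iotaPow 0 m a b ≠ 0) : 0 ≤ b := by
  intro i
  by_contra hi
  refine h (Finset.prod_eq_zero (Finset.mem_univ i) ?_)
  simp only [Pi.zero_apply] at hi ⊢
  simp [expCoeff, hi]

lemma iotaPow_zero_zero (a b : Fin n → ℤ) : iotaPow 0 0 a b = if a = 0 ∧ b = 0 then 1 else 0 := by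
  split_ifs with h
  · simp [iotaPow, h.1, h.2, expCoeff]
  · by_contra h'
    have h₁ := add_eq_of_iotaPow_ne_zero h'
    refine h' ?_
    have hb : b ≠ 0 := fun hb => h ⟨by simpa [hb] using h₁, hb⟩
    obtain ⟨i, hi⟩ := Function.ne_iff.1 hb
    refine Finset.prod_eq_zero (Finset.mem_univ i) ?_
    have := expCoeff_zero_eq 0 (b i)
    have h₂ := congrFun h₁ i
    simp only [Pi.add_apply, Pi.zero_apply] at h₂ hi ⊢
    rw [show a i = 0 - b i by lia, this, binom_zero_left, if_neg hi, zero_mul]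

lemma neg_one_pow_hammingNorm (α : Fin n → ZMod 2) :
    (-1 : ℂ) ^ hammingNorm α = ∏ i, if α i = 0 then 1 else -1 := by
  rw [Finset.prod_ite, Finset.prod_const_one, one_mul, Finset.prod_const]
  rfl

/-- The alternating sum of the expansions of `(x - y) ^ (-k)` is a derivative of the delta
function. -/
lemma sum_neg_one_pow_mul_iotaPow (k : ℕ) (a b : Fin n → ℤ) :
    ∑ α : Fin n → ZMod 2, (-1 : ℂ) ^ hammingNorm α * iotaPow α (fun _ => -(k : ℤ)) a b =
      if a + b = fun _ => -(k : ℤ) then multiBinom (-a - 1) (fun _ => (k : ℤ) - 1) else 0 := by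
  have h (i : Fin n) : ∑ s : ZMod 2, (if s = 0 then (1 : ℂ) else -1) * expCoeff s (-k) (a i) (b i) =
      if a i + b i = -k then binom (-a i - 1) (k - 1) else 0 := by
    rw [← expCoeff_zero_sub_expCoeff_one]
    rw [show (Finset.univ : Finset (ZMod 2)) = {0, 1} by decide,
      Finset.sum_pair (by decide), if_pos rfl, if_neg (by decide), one_mul, neg_one_mul,
      ← sub_eq_add_neg]
  simp only [neg_one_pow_hammingNorm, iotaPow, ← Finset.prod_mul_distrib]
  -- The sum over (F₂)ⁿ of a product over the coordinates factors into `n` sums of two terms.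
  rw [← Fintype.piFinset_univ, ← Finset.prod_univ_sum (fun _ => Finset.univ)
    (fun i s => (if s = 0 then (1 : ℂ) else -1) * expCoeff s (-k) (a i) (b i))]
  simp only [h]
  split_ifs with hab
  · refine Finset.prod_congr rfl fun i _ => ?_
    have hi : a i + b i = -k := congrFun hab i
    simp [hi]
  · obtain ⟨i, hi⟩ := Function.ne_iff.1 hab
    exact Finset.prod_eq_zero (Finset.mem_univ i) (if_neg hi)

/-- Upper negation gives y⁻¹δ((x - z)/y) = x⁻¹δ((y + z)/x), so the coefficient of x^a is the
expansion of (y + z)^(-a-1) in nonnegative powers of z. -/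
lemma deltaCoeff_eq (a b c : Fin n → ℤ) :
    deltaCoeff a b c = if a + b + c + 1 = 0 then multiBinom (-a - 1) c else 0 := by
  rw [deltaCoeff]
  split_ifs with h
  · refine Finset.prod_congr rfl fun i _ => ?_
    have hi : a i + b i + c i + 1 = 0 := congrFun h i
    have := expCoeff_zero_eq (-b i - 1) (c i)
    rw [show -b i - 1 - c i = a i by lia] at this
    simp only [Pi.zero_apply, Pi.sub_apply, Pi.neg_apply, Pi.one_apply]
    rw [this]
    rcases lt_or_ge (c i) 0 with hc | hc
    · simp [binom_of_neg _ hc]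
    · obtain ⟨r, hr⟩ := Int.eq_ofNat_of_zero_le hc
      rw [hr, zpow_natCast, show -a i - 1 = -(a i + 1) by ring, binom_neg, mul_comm,
        show a i + 1 + r - 1 = -b i - 1 by lia]
  · by_contra h'
    refine h ?_
    have h₁ := add_eq_of_iotaPow_ne_zero h'
    ext i
    have := congrFun h₁ i
    simp only [Pi.add_apply, Pi.one_apply, Pi.zero_apply] at this ⊢
    lia
end

section

variable {n : ℕ} {W W' : Type*} [AddCommGroup W] [Module ℂ W] [AddCommGroup W'] [Module ℂ W']

/-! ### Multiplication of series in two sets of variables by products of the `xᵢ - yᵢ` -/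

/-- Multiplication by `x ^ g y ^ h`. -/
def shiftMul (g h : Fin n → ℤ) : Module.End ℂ ((Fin n → ℤ) → (Fin n → ℤ) → W) where
  toFun f a b := f (a - g) (b - h)
  map_add' _ _ := rfl
  map_smul' _ _ := rfl

@[simp] lemma shiftMul_apply (g h : Fin n → ℤ) (f : (Fin n → ℤ) → (Fin n → ℤ) → W)
    (a b : Fin n → ℤ) : shiftMul g h f a b = f (a - g) (b - h) := rfl

lemma commute_shiftMul (g h g' h' : Fin n → ℤ) :
    Commute (shiftMul (W := W) g h) (shiftMul g' h') := by
  ext f a b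
  simp [sub_right_comm]

/-- Multiplication by `xᵢ - yᵢ`. -/
def diffMul (i : Fin n) : Module.End ℂ ((Fin n → ℤ) → (Fin n → ℤ) → W) :=
  shiftMul (unitVec i) 0 - shiftMul 0 (unitVec i)

lemma diffMul_apply (i : Fin n) (f : (Fin n → ℤ) → (Fin n → ℤ) → W) (a b : Fin n → ℤ) :
    diffMul i f a b = f (a - unitVec i) b - f a (b - unitVec i) := by
  simp [diffMul]

lemma commute_shiftMul_diffMul (g h : Fin n → ℤ) (i : Fin n) :
    Commute (shiftMul (W := W) g h) (diffMul i) :=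
  (commute_shiftMul _ _ _ _).sub_right (commute_shiftMul _ _ _ _)

/-- Multiplication by the product of the `xᵢ - yᵢ` over a list of indices. -/
def diffProd (L : List (Fin n)) : Module.End ℂ ((Fin n → ℤ) → (Fin n → ℤ) → W) :=
  (L.map diffMul).prod

/-- The multidegree of a list of indices. -/
def listDeg (L : List (Fin n)) : Fin n → ℤ := (L.map fun i => unitVec i).sum

@[simp] lemma listDeg_nil : listDeg ([] : List (Fin n)) = 0 := rfl

lemma listDeg_cons (i : Fin n) (L : List (Fin n)) : listDeg (i :: L) = unitVec i + listDeg L := by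
  simp [listDeg]

lemma listDeg_append (L L' : List (Fin n)) : listDeg (L ++ L') = listDeg L + listDeg L' := by
  simp [listDeg]

lemma listDeg_flatten_ofFn {k : ℕ} (G : Fin k → List (Fin n)) :
    listDeg (List.ofFn G).flatten = ∑ j, listDeg (G j) := by
  induction k with
  | zero => simp
  | succ k ih => rw [List.ofFn_succ, List.flatten_cons, listDeg_append, ih, Fin.sum_univ_succ]

/-- Lists of indices stand for monomials in the xᵢ - yᵢ, so that arguments can remove one factor at
a time; this recovers powers with prescribed exponents. -/
lemma exists_listDeg_eq {κ : Fin n → ℤ} (hκ : 0 ≤ κ) : ∃ L, listDeg L = κ := by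
  refine ⟨(List.ofFn fun i => List.replicate (κ i).toNat i).flatten, ?_⟩
  have h (i : Fin n) : listDeg (List.replicate (κ i).toNat i) = Pi.single i (κ i) := by
    simp only [listDeg, List.map_replicate, List.sum_replicate, ← Pi.single_smul, nsmul_eq_mul,
      mul_one]
    rw [Int.toNat_of_nonneg (hκ i)]
  rw [listDeg_flatten_ofFn]
  simp only [h, Finset.univ_sum_single]

@[simp] lemma diffProd_nil (f : (Fin n → ℤ) → (Fin n → ℤ) → W) : diffProd [] f = f := rfl

lemma diffProd_cons (i : Fin n) (L : List (Fin n)) (f : (Fin n → ℤ) → (Fin n → ℤ) → W) :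
    diffProd (i :: L) f = diffMul i (diffProd L f) := by
  simp [diffProd]

lemma diffProd_append (L L' : List (Fin n)) (f : (Fin n → ℤ) → (Fin n → ℤ) → W) :
    diffProd (L ++ L') f = diffProd L (diffProd L' f) := by
  simp [diffProd]

lemma commute_shiftMul_diffProd (g h : Fin n → ℤ) (L : List (Fin n)) :
    Commute (shiftMul (W := W) g h) (diffProd L) := by
  refine Commute.list_prod_right _ _ fun x hx => ?_
  obtain ⟨i, -, rfl⟩ := List.mem_map.1 hx
  exact commute_shiftMul_diffMul g h i

lemma commute_diffMul_diffProd (i : Fin n) (L : List (Fin n)) :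
    Commute (diffMul (W := W) i) (diffProd L) :=
  (commute_shiftMul_diffProd _ _ L).sub_left (commute_shiftMul_diffProd _ _ L)

lemma diffProd_shiftMul (g h : Fin n → ℤ) (L : List (Fin n))
    (f : (Fin n → ℤ) → (Fin n → ℤ) → W) :
    diffProd L (shiftMul g h f) = shiftMul g h (diffProd L f) :=
  (LinearMap.congr_fun (commute_shiftMul_diffProd g h L).eq f).symm

lemma diffProd_diffMul (i : Fin n) (L : List (Fin n)) (f : (Fin n → ℤ) → (Fin n → ℤ) → W) :
    diffProd L (diffMul i f) = diffMul i (diffProd L f) :=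
  (LinearMap.congr_fun (commute_diffMul_diffProd i L).eq f).symm

lemma diffProd_comm (L L' : List (Fin n)) (f : (Fin n → ℤ) → (Fin n → ℤ) → W) :
    diffProd L (diffProd L' f) = diffProd L' (diffProd L f) := by
  induction L with
  | nil => rfl
  | cons i L ih => rw [diffProd_cons, diffProd_cons, ih, diffProd_diffMul]

lemma diffProd_map (φ : W →ₗ[ℂ] W') (L : List (Fin n)) (f : (Fin n → ℤ) → (Fin n → ℤ) → W) :
    (diffProd L fun a b => φ (f a b)) = fun a b => φ (diffProd L f a b) := by
  induction L with
  | nil => rfl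
  | cons i L ih =>
    ext a b
    simp [diffProd_cons, ih, diffMul_apply]

lemma diffProd_swap (L : List (Fin n)) (f : (Fin n → ℤ) → (Fin n → ℤ) → W) (a b : Fin n → ℤ) :
    diffProd L (fun a b => f b a) a b = (-1 : ℂ) ^ L.length • diffProd L f b a := by
  induction L generalizing a b with
  | nil => simp
  | cons i L ih =>
    rw [diffProd_cons, diffProd_cons, diffMul_apply, diffMul_apply, ih, ih, List.length_cons,
      pow_succ, mul_neg_one, neg_smul, ← smul_sub, ← smul_neg, neg_sub]

/-! ### Truncation -/

/-- The exponents of the second set of variables are bounded below. -/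
def TruncatedRight (f : (Fin n → ℤ) → (Fin n → ℤ) → W) : Prop :=
  ∃ N : ℤ, ∀ a b : Fin n → ℤ, (∃ i, b i < N) → f a b = 0

/-- The exponents of the first set of variables are bounded below. -/
def TruncatedLeft (f : (Fin n → ℤ) → (Fin n → ℤ) → W) : Prop :=
  ∃ N : ℤ, ∀ a b : Fin n → ℤ, (∃ i, a i < N) → f a b = 0

lemma lowerTruncated₂_iff {f : (Fin n → ℤ) → (Fin n → ℤ) → W} :
    LowerTruncated₂ f ↔ TruncatedLeft f ∧ TruncatedRight f := by
  constructor
  · rintro ⟨N, hN⟩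
    exact ⟨⟨N, fun a b ⟨i, hi⟩ => hN a b ⟨i, .inl hi⟩⟩, ⟨N, fun a b ⟨i, hi⟩ => hN a b ⟨i, .inr hi⟩⟩⟩
  · rintro ⟨⟨N, hN⟩, ⟨M, hM⟩⟩
    refine ⟨min N M, fun a b ⟨i, hi⟩ => ?_⟩
    rcases hi with hi | hi
    · exact hN a b ⟨i, lt_of_lt_of_le hi (min_le_left _ _)⟩
    · exact hM a b ⟨i, lt_of_lt_of_le hi (min_le_right _ _)⟩

lemma TruncatedRight.sub {f g : (Fin n → ℤ) → (Fin n → ℤ) → W} (hf : TruncatedRight f)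
    (hg : TruncatedRight g) : TruncatedRight (f - g) := by
  obtain ⟨N, hN⟩ := hf
  obtain ⟨M, hM⟩ := hg
  refine ⟨min N M, fun a b ⟨i, hi⟩ => ?_⟩
  simp [hN a b ⟨i, lt_of_lt_of_le hi (min_le_left _ _)⟩,
    hM a b ⟨i, lt_of_lt_of_le hi (min_le_right _ _)⟩]

lemma TruncatedLeft.sub {f g : (Fin n → ℤ) → (Fin n → ℤ) → W} (hf : TruncatedLeft f)
    (hg : TruncatedLeft g) : TruncatedLeft (f - g) := by
  obtain ⟨N, hN⟩ := hf
  obtain ⟨M, hM⟩ := hg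
  refine ⟨min N M, fun a b ⟨i, hi⟩ => ?_⟩
  simp [hN a b ⟨i, lt_of_lt_of_le hi (min_le_left _ _)⟩,
    hM a b ⟨i, lt_of_lt_of_le hi (min_le_right _ _)⟩]

lemma exists_forall_le (g : Fin n → ℤ) : ∃ M : ℤ, ∀ i, M ≤ g i := by
  obtain ⟨M, hM⟩ := (Set.finite_range g).bddBelow
  exact ⟨M, fun i => hM ⟨i, rfl⟩⟩

lemma exists_forall_ge (g : Fin n → ℤ) : ∃ M : ℤ, ∀ i, g i ≤ M := by
  obtain ⟨M, hM⟩ := (Set.finite_range g).bddAbove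
  exact ⟨M, fun i => hM ⟨i, rfl⟩⟩

lemma TruncatedRight.shiftMul {f : (Fin n → ℤ) → (Fin n → ℤ) → W} (hf : TruncatedRight f)
    (g h : Fin n → ℤ) : TruncatedRight (shiftMul g h f) := by
  obtain ⟨N, hN⟩ := hf
  obtain ⟨M, hM⟩ := exists_forall_le h
  refine ⟨N + M, fun a b ⟨i, hi⟩ => hN _ _ ⟨i, ?_⟩⟩
  have := hM i
  simp only [Pi.sub_apply]
  lia

lemma TruncatedLeft.shiftMul {f : (Fin n → ℤ) → (Fin n → ℤ) → W} (hf : TruncatedLeft f)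
    (g h : Fin n → ℤ) : TruncatedLeft (shiftMul g h f) := by
  obtain ⟨N, hN⟩ := hf
  obtain ⟨M, hM⟩ := exists_forall_le g
  refine ⟨N + M, fun a b ⟨i, hi⟩ => hN _ _ ⟨i, ?_⟩⟩
  have := hM i
  simp only [Pi.sub_apply]
  lia

lemma TruncatedRight.diffProd {f : (Fin n → ℤ) → (Fin n → ℤ) → W} (hf : TruncatedRight f)
    (L : List (Fin n)) : TruncatedRight (diffProd L f) := by
  induction L with
  | nil => exact hf
  | cons i L ih =>
    rw [diffProd_cons]
    exact (ih.shiftMul _ _).sub (ih.shiftMul _ _)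

lemma TruncatedLeft.diffProd {f : (Fin n → ℤ) → (Fin n → ℤ) → W} (hf : TruncatedLeft f)
    (L : List (Fin n)) : TruncatedLeft (diffProd L f) := by
  induction L with
  | nil => exact hf
  | cons i L ih =>
    rw [diffProd_cons]
    exact (ih.shiftMul _ _).sub (ih.shiftMul _ _)

namespace LowerTruncated₂

variable {f g : (Fin n → ℤ) → (Fin n → ℤ) → W}

lemma shiftMul (hf : LowerTruncated₂ f) (g h : Fin n → ℤ) : LowerTruncated₂ (shiftMul g h f) := by
  rw [lowerTruncated₂_iff] at hf ⊢
  exact ⟨hf.1.shiftMul g h, hf.2.shiftMul g h⟩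

lemma sub (hf : LowerTruncated₂ f) (hg : LowerTruncated₂ g) : LowerTruncated₂ (f - g) := by
  rw [lowerTruncated₂_iff] at hf hg ⊢
  exact ⟨hf.1.sub hg.1, hf.2.sub hg.2⟩

lemma diffMul (hf : LowerTruncated₂ f) (i : Fin n) : LowerTruncated₂ (diffMul i f) :=
  (hf.shiftMul _ _).sub (hf.shiftMul _ _)

lemma diffProd (hf : LowerTruncated₂ f) (L : List (Fin n)) : LowerTruncated₂ (diffProd L f) := by
  rw [lowerTruncated₂_iff] at hf ⊢
  exact ⟨hf.1.diffProd L, hf.2.diffProd L⟩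

lemma map (hf : LowerTruncated₂ f) (φ : W →ₗ[ℂ] W') : LowerTruncated₂ fun a b => φ (f a b) := by
  obtain ⟨N, hN⟩ := hf
  exact ⟨N, fun a b h => by simp [hN a b h]⟩

lemma smul (hf : LowerTruncated₂ f) (c : ℂ) : LowerTruncated₂ (c • f) := by
  obtain ⟨N, hN⟩ := hf
  exact ⟨N, fun a b h => by simp [hN a b h]⟩

lemma neg (hf : LowerTruncated₂ f) : LowerTruncated₂ (-f) := by
  obtain ⟨N, hN⟩ := hf
  exact ⟨N, fun a b h => by simp [hN a b h]⟩

lemma add (hf : LowerTruncated₂ f) (hg : LowerTruncated₂ g) : LowerTruncated₂ (f + g) := by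
  rw [← sub_neg_eq_add]
  exact hf.sub hg.neg

/-- Along an antidiagonal, lower bounds on both exponents confine the first one to a box. This makes
the substitution x = y + z meaningful coefficientwise. -/
lemma finite_support (hf : LowerTruncated₂ f) (φ : (Fin n → ℤ) → ℂ) (g t : Fin n → ℤ) :
    (support fun a => φ a • f (a - g) (t - a)).Finite := by
  obtain ⟨N, hN⟩ := hf
  refine (Set.finite_Icc ((fun _ => N) + g) (t - fun _ => N)).subset fun a ha => ?_
  by_contra h
  refine ha ?_
  have : ∃ i, (a - g) i < N ∨ (t - a) i < N := by
    by_contra! h'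
    refine h ⟨fun i => ?_, fun i => ?_⟩ <;> have := h' i <;>
      simp only [Pi.sub_apply, Pi.add_apply] at this ⊢ <;> lia
  simp [hN _ _ this]

end LowerTruncated₂

/-! ### Taylor expansion along the diagonal -/

/-- The coefficient of `z ^ c y ^ b` in `f(y + z, y)`. -/
noncomputable def taylor (f : (Fin n → ℤ) → (Fin n → ℤ) → W) (c b : Fin n → ℤ) : W :=
  ∑ᶠ a, multiBinom a c • f a (b + c - a)

lemma finite_support_taylor {f : (Fin n → ℤ) → (Fin n → ℤ) → W} (hf : LowerTruncated₂ f)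
    (c b : Fin n → ℤ) : (support fun a => multiBinom a c • f a (b + c - a)).Finite := by
  simpa using hf.finite_support (fun a => multiBinom a c) 0 (b + c)

lemma taylor_eq_sum {f : (Fin n → ℤ) → (Fin n → ℤ) → W} {c b : Fin n → ℤ}
    {s : Finset (Fin n → ℤ)} (hs : ∀ a ∉ s, f a (b + c - a) = 0) :
    taylor f c b = ∑ a ∈ s, multiBinom a c • f a (b + c - a) := by
  refine finsum_eq_sum_of_support_subset _ fun a ha => ?_
  by_contra h
  exact ha (by simp [hs a h])

lemma taylor_of_neg (f : (Fin n → ℤ) → (Fin n → ℤ) → W) {c : Fin n → ℤ} (b : Fin n → ℤ)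
    {i : Fin n} (hc : c i < 0) : taylor f c b = 0 := by
  simp [taylor, multiBinom_of_neg _ hc]

lemma taylor_eq_zero {f : (Fin n → ℤ) → (Fin n → ℤ) → W} {N : ℤ}
    (hN : ∀ a b : Fin n → ℤ, (∃ i, a i < N ∨ b i < N) → f a b = 0) {c b : Fin n → ℤ}
    {i : Fin n} (hb : b i + c i < N + N) : taylor f c b = 0 := by
  refine finsum_eq_zero_of_forall_eq_zero fun a => ?_
  rw [hN, smul_zero]
  refine ⟨i, ?_⟩
  simp only [Pi.add_apply, Pi.sub_apply]
  lia

lemma lowerTruncated_taylor {f : (Fin n → ℤ) → (Fin n → ℤ) → W} (hf : LowerTruncated₂ f)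
    (c : Fin n → ℤ) : LowerTruncated fun b => taylor f c b := by
  obtain ⟨N, hN⟩ := hf
  obtain ⟨M, hM⟩ := exists_forall_ge c
  refine ⟨N + N - M, fun b ⟨i, hi⟩ => taylor_eq_zero hN (i := i) ?_⟩
  have := hM i
  lia

lemma taylor_sub {f g : (Fin n → ℤ) → (Fin n → ℤ) → W} (hf : LowerTruncated₂ f)
    (hg : LowerTruncated₂ g) (c b : Fin n → ℤ) :
    taylor (f - g) c b = taylor f c b - taylor g c b := by
  simp only [taylor, Pi.sub_apply, smul_sub]
  exact finsum_sub_distrib (finite_support_taylor hf c b) (finite_support_taylor hg c b)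

lemma taylor_map (φ : W →ₗ[ℂ] W') {f : (Fin n → ℤ) → (Fin n → ℤ) → W} (hf : LowerTruncated₂ f)
    (c b : Fin n → ℤ) : taylor (fun a b => φ (f a b)) c b = φ (taylor f c b) := by
  rw [taylor, taylor, map_finsum φ (finite_support_taylor hf c b)]
  simp

lemma taylor_shiftMul_right (f : (Fin n → ℤ) → (Fin n → ℤ) → W) (g c b : Fin n → ℤ) :
    taylor (shiftMul 0 g f) c b = taylor f c (b - g) := by
  simp only [taylor, shiftMul_apply, sub_zero]
  refine finsum_congr fun a => ?_
  rw [show b + c - a - g = b - g + c - a by abel]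

lemma taylor_shiftMul_left (f : (Fin n → ℤ) → (Fin n → ℤ) → W) (g c b : Fin n → ℤ) :
    taylor (shiftMul g 0 f) c b = ∑ᶠ a, multiBinom (a + g) c • f a (b - g + c - a) := by
  rw [taylor, ← finsum_comp_equiv (Equiv.addRight g)]
  refine finsum_congr fun a => ?_
  simp only [Equiv.coe_addRight, shiftMul_apply, sub_zero, add_sub_cancel_right]
  rw [show b + c - (a + g) = b - g + c - a by abel]

lemma taylor_shiftMul_unitVec {f : (Fin n → ℤ) → (Fin n → ℤ) → W} (hf : LowerTruncated₂ f)
    (i : Fin n) (c b : Fin n → ℤ) :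
    taylor (shiftMul (unitVec i) 0 f) c b =
      taylor f (c - unitVec i) b + taylor f c (b - unitVec i) := by
  rw [taylor_shiftMul_left, taylor, taylor]
  have h := finite_support_taylor hf
  rw [← finsum_add_distrib (h _ _) (h _ _)]
  refine finsum_congr fun a => ?_
  rw [multiBinom_succ, add_smul, add_comm,
    show b + (c - unitVec i) - a = b - unitVec i + c - a by abel]

/-- By Pascal's rule xᵢ becomes yᵢ + zᵢ, and yᵢ cancels: multiplication by xᵢ - yᵢ is a mere shift
in z. -/
lemma taylor_diffMul {f : (Fin n → ℤ) → (Fin n → ℤ) → W} (hf : LowerTruncated₂ f)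
    (i : Fin n) (c b : Fin n → ℤ) :
    taylor (diffMul i f) c b = taylor f (c - unitVec i) b := by
  rw [diffMul, LinearMap.sub_apply, taylor_sub (hf.shiftMul _ _) (hf.shiftMul _ _),
    taylor_shiftMul_unitVec hf, taylor_shiftMul_right, add_sub_cancel_right]

lemma taylor_diffProd {f : (Fin n → ℤ) → (Fin n → ℤ) → W} (hf : LowerTruncated₂ f)
    (L : List (Fin n)) (c b : Fin n → ℤ) :
    taylor (diffProd L f) (c + listDeg L) b = taylor f c b := by
  induction L with
  | nil => simp
  | cons i L ih =>
    rw [diffProd_cons, taylor_diffMul (hf.diffProd L), listDeg_cons, ← ih,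
      show c + (unitVec i + listDeg L) - unitVec i = c + listDeg L by abel]

/-- The expansion of `(y + z) ^ g f(y + z, y)`. -/
lemma taylor_shiftMul {f : (Fin n → ℤ) → (Fin n → ℤ) → W} (hf : LowerTruncated₂ f)
    (g c b : Fin n → ℤ) :
    taylor (shiftMul g 0 f) c b =
      ∑ r ∈ Finset.Icc 0 c, multiBinom g r • taylor f (c - r) (b - g + r) := by
  rw [taylor_shiftMul_left]
  simp only [taylor, multiBinom_add, Finset.sum_smul]
  rw [finsum_sum_comm]
  · refine Finset.sum_congr rfl fun r _ => ?_
    rw [smul_finsum' _ (finite_support_taylor hf _ _)]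
    refine finsum_congr fun a => ?_
    rw [mul_smul, show b - g + r + (c - r) - a = b - g + c - a by abel]
  · intro r _
    have := hf.finite_support (fun a => multiBinom g r * multiBinom a (c - r)) 0 (b - g + c)
    simp only [sub_zero] at this
    exact this

/-! ### Diagonal expansion of series with poles along the diagonal -/

/-- Some product of the `xᵢ - yᵢ` maps `f` to `W((x, y))`. -/
def Clearable (f : (Fin n → ℤ) → (Fin n → ℤ) → W) : Prop :=
  ∃ L : List (Fin n), LowerTruncated₂ (diffProd L f)

open scoped Classical in
/-- The coefficient of `z ^ c y ^ b` in `z ^ (-k) (z ^ k f(y + z, y))`, where the product of `f(x, y)`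
with `(x - y) ^ k` is in `W((x, y))`. -/
noncomputable def diagExp (f : (Fin n → ℤ) → (Fin n → ℤ) → W) (c b : Fin n → ℤ) : W :=
  if h : Clearable f then taylor (diffProd h.choose f) (c + listDeg h.choose) b else 0

/-- Two clearing lists are compared by applying both: each further factor only shifts the exponent
of z, and the factors commute. -/
lemma diagExp_eq {f : (Fin n → ℤ) → (Fin n → ℤ) → W} {L : List (Fin n)}
    (hL : LowerTruncated₂ (diffProd L f)) (c b : Fin n → ℤ) :
    diagExp f c b = taylor (diffProd L f) (c + listDeg L) b := by
  have h : Clearable f := ⟨L, hL⟩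
  rw [diagExp, dif_pos h, ← taylor_diffProd h.choose_spec L, ← taylor_diffProd hL h.choose,
    diffProd_comm, add_right_comm]

lemma diagExp_eq_taylor {f : (Fin n → ℤ) → (Fin n → ℤ) → W} (hf : LowerTruncated₂ f)
    (c b : Fin n → ℤ) : diagExp f c b = taylor f c b := by
  rw [diagExp_eq (L := []) hf]
  simp

namespace Clearable

variable {f g : (Fin n → ℤ) → (Fin n → ℤ) → W}

lemma of_diffProd {L : List (Fin n)} (h : Clearable (diffProd L f)) : Clearable f := by
  obtain ⟨L', h'⟩ := h
  exact ⟨L' ++ L, by rwa [diffProd_append]⟩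

lemma shiftMul (hf : Clearable f) (g h : Fin n → ℤ) : Clearable (shiftMul g h f) := by
  obtain ⟨L, hL⟩ := hf
  exact ⟨L, by rw [diffProd_shiftMul]; exact hL.shiftMul g h⟩

lemma sub (hf : Clearable f) (hg : Clearable g) : Clearable (f - g) := by
  obtain ⟨L, hL⟩ := hf
  obtain ⟨L', hL'⟩ := hg
  refine ⟨L ++ L', ?_⟩
  rw [map_sub, diffProd_append, diffProd_append, diffProd_comm]
  exact (hL.diffProd L').sub (diffProd_comm L L' g ▸ (diffProd_comm L' L g ▸ hL'.diffProd L))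

lemma smul (hf : Clearable f) (c : ℂ) : Clearable (c • f) := by
  obtain ⟨L, hL⟩ := hf
  exact ⟨L, by rw [map_smul]; exact hL.smul c⟩

lemma add (hf : Clearable f) (hg : Clearable g) : Clearable (f + g) := by
  have := hf.sub (hg.smul (-1))
  rwa [neg_smul, one_smul, sub_neg_eq_add] at this

lemma diffMul (hf : Clearable f) (i : Fin n) : Clearable (diffMul i f) :=
  (hf.shiftMul _ _).sub (hf.shiftMul _ _)

lemma map (hf : Clearable f) (φ : W →ₗ[ℂ] W') : Clearable fun a b => φ (f a b) := by
  obtain ⟨L, hL⟩ := hf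
  exact ⟨L, by rw [diffProd_map]; exact hL.map φ⟩

end Clearable

section

variable {f g : (Fin n → ℤ) → (Fin n → ℤ) → W}

lemma diagExp_sub (hf : Clearable f) (hg : Clearable g) (c b : Fin n → ℤ) :
    diagExp (f - g) c b = diagExp f c b - diagExp g c b := by
  obtain ⟨L, hL⟩ := hf
  obtain ⟨L', hL'⟩ := hg
  have h₁ : LowerTruncated₂ (diffProd (L ++ L') f) := by
    rw [diffProd_append, diffProd_comm]
    exact hL.diffProd L'
  have h₂ : LowerTruncated₂ (diffProd (L ++ L') g) := by
    rw [diffProd_append]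
    exact hL'.diffProd L
  rw [diagExp_eq h₁, diagExp_eq h₂, diagExp_eq (L := L ++ L') (by rw [map_sub]; exact h₁.sub h₂),
    map_sub, taylor_sub h₁ h₂]

lemma diagExp_map (φ : W →ₗ[ℂ] W') (hf : Clearable f) (c b : Fin n → ℤ) :
    diagExp (fun a b => φ (f a b)) c b = φ (diagExp f c b) := by
  obtain ⟨L, hL⟩ := hf
  rw [diagExp_eq hL, diagExp_eq (L := L) (by rw [diffProd_map]; exact hL.map φ), diffProd_map,
    taylor_map φ hL]

lemma diagExp_smul (r : ℂ) (hf : Clearable f) (c b : Fin n → ℤ) :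
    diagExp (r • f) c b = r • diagExp f c b :=
  diagExp_map (LinearMap.lsmul ℂ W r) hf c b

lemma diagExp_zero (c b : Fin n → ℤ) :
    diagExp (0 : (Fin n → ℤ) → (Fin n → ℤ) → W) c b = 0 := by
  rw [diagExp_eq_taylor (f := 0) ⟨0, fun _ _ _ => rfl⟩]
  simp [taylor]

lemma diagExp_add (hf : Clearable f) (hg : Clearable g) (c b : Fin n → ℤ) :
    diagExp (f + g) c b = diagExp f c b + diagExp g c b := by
  have := diagExp_sub (hf.add hg) hg c b
  rw [add_sub_cancel_right] at this
  rw [this, sub_add_cancel]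

lemma diagExp_shiftMul_right (hf : Clearable f) (g c b : Fin n → ℤ) :
    diagExp (shiftMul 0 g f) c b = diagExp f c (b - g) := by
  obtain ⟨L, hL⟩ := hf
  rw [diagExp_eq hL, diagExp_eq (L := L) (by rw [diffProd_shiftMul]; exact hL.shiftMul _ _),
    diffProd_shiftMul, taylor_shiftMul_right]

lemma diagExp_diffMul (hf : Clearable f) (i : Fin n) (c b : Fin n → ℤ) :
    diagExp (diffMul i f) c b = diagExp f (c - unitVec i) b := by
  obtain ⟨L, hL⟩ := hf
  rw [diagExp_eq hL, diagExp_eq (L := L) (by rw [diffProd_diffMul]; exact hL.diffMul i),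
    diffProd_diffMul, taylor_diffMul hL, sub_add_eq_add_sub]

/-- The pole order in z is bounded by the clearing list alone, whatever the truncation bound of the
cleared series. The inductions on pole order start here. -/
lemma diagExp_of_lt {L : List (Fin n)} (hL : LowerTruncated₂ (diffProd L f)) {c : Fin n → ℤ}
    (b : Fin n → ℤ) {i : Fin n} (hc : c i + listDeg L i < 0) : diagExp f c b = 0 := by
  rw [diagExp_eq hL]
  exact taylor_of_neg _ _ hc

lemma lowerTruncated_diagExp (hf : Clearable f) (c : Fin n → ℤ) :
    LowerTruncated fun b => diagExp f c b := by
  obtain ⟨L, hL⟩ := hf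
  simp only [diagExp_eq hL]
  exact lowerTruncated_taylor hL _

/-- The expansion of `(y + z) ^ g f(y + z, y)`. -/
lemma diagExp_shiftMul {L : List (Fin n)} (hL : LowerTruncated₂ (diffProd L f))
    (g c b : Fin n → ℤ) :
    diagExp (shiftMul g 0 f) c b =
      ∑ r ∈ Finset.Icc 0 (c + listDeg L), multiBinom g r • diagExp f (c - r) (b - g + r) := by
  rw [diagExp_eq (L := L) (by rw [diffProd_shiftMul]; exact hL.shiftMul _ _), diffProd_shiftMul,
    taylor_shiftMul hL]
  refine Finset.sum_congr rfl fun r _ => ?_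
  rw [diagExp_eq hL, sub_add_eq_add_sub c r]

end
end

section

variable {n : ℕ} {W : Type*} [AddCommGroup W] [Module ℂ W]

/-! ### Products with expansions of powers of `x - y` -/

lemma opSum_apply {ι : Type*} {F : ι → Module.End ℂ W} (h : ∀ w, (support fun i => F i w).Finite)
    (w : W) : opSum F w = ∑ᶠ i, F i w := by
  rw [opSum, dif_pos h]
  rfl

lemma finsum_eq_finsum_comp {ι κ : Type*} {G : κ → W} {j : ι → κ} (hj : Injective j)
    (hG : support G ⊆ Set.range j) : ∑ᶠ x, G x = ∑ᶠ i, G (j i) := by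
  rw [← finsum_mem_range hj, ← finsum_mem_inter_support, Set.inter_eq_right.2 hG,
    finsum_mem_support]

lemma finsum_comp_sub_finsum_comp {ι : Type*} {G H : ι → W} (e e' : Equiv.Perm ι)
    (hG : (support G).Finite) (hH : (support H).Finite) :
    ∑ᶠ i, (G ∘ e - H ∘ e') i = ∑ᶠ i, G i - ∑ᶠ i, H i := by
  rw [← finsum_comp_equiv e (f := G), ← finsum_comp_equiv e' (f := H)]
  exact finsum_sub_distrib (hG.preimage e.injective.injOn) (hH.preimage e'.injective.injOn)

/-- The product of `f` and of `ι_α((x - y) ^ m)` exists. -/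
def HasExpMul (α : Fin n → ZMod 2) (m : Fin n → ℤ) (f : (Fin n → ℤ) → (Fin n → ℤ) → W) : Prop :=
  ∀ a b, (support fun r : (Fin n → ℤ) × (Fin n → ℤ) =>
    iotaPow α m r.1 r.2 • f (a - r.1) (b - r.2)).Finite

/-- The product of `f` and of `ι_α((x - y) ^ m)`. -/
noncomputable def expMul (α : Fin n → ZMod 2) (m : Fin n → ℤ)
    (f : (Fin n → ℤ) → (Fin n → ℤ) → W) : (Fin n → ℤ) → (Fin n → ℤ) → W :=
  fun a b => ∑ᶠ r : (Fin n → ℤ) × (Fin n → ℤ), iotaPow α m r.1 r.2 • f (a - r.1) (b - r.2)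

lemma mulSeries_apply {α : Fin n → ZMod 2} {m : Fin n → ℤ} {F : OpSeries₂ n W}
    (h : ∀ w, HasExpMul α m fun a b => F a b w) (a b : Fin n → ℤ) (w : W) :
    mulSeries (iotaPow α m) F a b w = expMul α m (fun a b => F a b w) a b := by
  rw [mulSeries, opSum_apply]
  · rfl
  · exact fun w => h w a b

section

variable {f : (Fin n → ℤ) → (Fin n → ℤ) → W}

/-- Translating the summation index moves the shift from the scalar coefficients to `f`. -/
lemma iotaPow_succ_smul (α : Fin n → ZMod 2) (m : Fin n → ℤ) (i : Fin n) (a b : Fin n → ℤ) :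
    (fun r : (Fin n → ℤ) × (Fin n → ℤ) =>
      iotaPow α (m + unitVec i) r.1 r.2 • f (a - r.1) (b - r.2)) =
    (fun r => iotaPow α m r.1 r.2 • f (a - unitVec i - r.1) (b - r.2)) ∘
        Equiv.subRight ((unitVec i, 0) : (Fin n → ℤ) × (Fin n → ℤ)) -
      (fun r => iotaPow α m r.1 r.2 • f (a - r.1) (b - unitVec i - r.2)) ∘
        Equiv.subRight ((0, unitVec i) : (Fin n → ℤ) × (Fin n → ℤ)) := by
  ext r
  simp [iotaPow_succ, sub_smul]

lemma HasExpMul.succ {α : Fin n → ZMod 2} {m : Fin n → ℤ} (h : HasExpMul α m f) (i : Fin n) :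
    HasExpMul α (m + unitVec i) f := by
  intro a b
  rw [iotaPow_succ_smul]
  refine Set.Finite.subset (Set.Finite.union ?_ ?_) (support_sub _ _)
  · rw [support_comp_eq_preimage]
    exact (h _ _).preimage (Equiv.injective _).injOn
  · rw [support_comp_eq_preimage]
    exact (h _ _).preimage (Equiv.injective _).injOn

lemma expMul_succ {α : Fin n → ZMod 2} {m : Fin n → ℤ} (h : HasExpMul α m f) (i : Fin n) :
    expMul α (m + unitVec i) f = diffMul i (expMul α m f) := by
  ext a b
  rw [expMul, iotaPow_succ_smul, diffMul_apply]
  exact finsum_comp_sub_finsum_comp _ _ (h _ _) (h _ _)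

lemma HasExpMul.listDeg_add {α : Fin n → ZMod 2} {m : Fin n → ℤ} (h : HasExpMul α m f)
    (L : List (Fin n)) : HasExpMul α (listDeg L + m) f := by
  induction L with
  | nil => simpa using h
  | cons i L ih =>
    rw [listDeg_cons, add_assoc, add_comm]
    exact ih.succ i

lemma expMul_listDeg_add {α : Fin n → ZMod 2} {m : Fin n → ℤ} (h : HasExpMul α m f)
    (L : List (Fin n)) : expMul α (listDeg L + m) f = diffProd L (expMul α m f) := by
  induction L with
  | nil => simp
  | cons i L ih =>
    rw [listDeg_cons, add_assoc, add_comm, expMul_succ (h.listDeg_add L), ih, diffProd_cons]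

lemma hasExpMul_zero (f : (Fin n → ℤ) → (Fin n → ℤ) → W) : HasExpMul 0 0 f := by
  intro a b
  refine (Set.finite_singleton 0).subset fun r hr => ?_
  by_contra h
  refine hr ?_
  simp only [iotaPow_zero_zero]
  rw [if_neg fun h' => h (Prod.ext h'.1 h'.2), zero_smul]

lemma expMul_zero (f : (Fin n → ℤ) → (Fin n → ℤ) → W) : expMul 0 0 f = f := by
  ext a b
  rw [expMul, finsum_eq_single _ 0]
  · simp [iotaPow_zero_zero]
  · intro r hr
    rw [iotaPow_zero_zero, if_neg fun h' => hr (Prod.ext h'.1 h'.2), zero_smul]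

lemma hasExpMul_listDeg (f : (Fin n → ℤ) → (Fin n → ℤ) → W) (L : List (Fin n)) :
    HasExpMul 0 (listDeg L) f := by
  simpa using (hasExpMul_zero f).listDeg_add L

lemma expMul_listDeg (f : (Fin n → ℤ) → (Fin n → ℤ) → W) (L : List (Fin n)) :
    expMul 0 (listDeg L) f = diffProd L f := by
  simpa [expMul_zero] using expMul_listDeg_add (hasExpMul_zero f) L

/-- (x - y)^m has only nonnegative powers of y, so truncation of `f` in y suffices for α = 0; other
α need truncation in both variables. -/
lemma TruncatedRight.hasExpMul (hf : TruncatedRight f) (m : Fin n → ℤ) : HasExpMul 0 m f := by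
  intro a b
  obtain ⟨N, hN⟩ := hf
  refine ((Set.finite_Icc 0 (b - fun _ => N)).image fun q => (m - q, q)).subset fun r hr => ?_
  rw [mem_support, smul_ne_zero_iff] at hr
  refine ⟨r.2, ⟨nonneg_of_iotaPow_zero_ne_zero hr.1, fun i => ?_⟩, ?_⟩
  · by_contra h
    refine hr.2 (hN _ _ ⟨i, ?_⟩)
    simp only [Pi.sub_apply] at h ⊢
    lia
  · have := add_eq_of_iotaPow_ne_zero hr.1
    simp [← this]

lemma LowerTruncated₂.hasExpMul (hf : LowerTruncated₂ f) (α : Fin n → ZMod 2) (m : Fin n → ℤ) :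
    HasExpMul α m f := by
  intro a b
  obtain ⟨N, hN⟩ := hf
  refine ((Set.finite_Icc (m - a + fun _ => N) (b - fun _ => N)).image
    fun q => (m - q, q)).subset fun r hr => ?_
  rw [mem_support, smul_ne_zero_iff] at hr
  have hm := add_eq_of_iotaPow_ne_zero hr.1
  refine ⟨r.2, ⟨fun i => ?_, fun i => ?_⟩, ?_⟩
  · by_contra h
    refine hr.2 (hN _ _ ⟨i, ?_⟩)
    simp only [← hm, Pi.sub_apply, Pi.add_apply] at h ⊢
    lia
  · by_contra h
    refine hr.2 (hN _ _ ⟨i, ?_⟩)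
    simp only [Pi.sub_apply] at h ⊢
    lia
  · simp [← hm]

/-- The alternating sum of the expansions of `(x - y) ^ (-k) f(x, y)` is given by the Taylor
expansion of `f` along the diagonal. -/
lemma sum_expMul (hf : LowerTruncated₂ f) (k : ℕ) (a b : Fin n → ℤ) :
    ∑ α : Fin n → ZMod 2, (-1 : ℂ) ^ hammingNorm α • expMul α (fun _ => -(k : ℤ)) f a b =
      taylor (shiftMul (-a - 1) 0 f) (fun _ => (k : ℤ) - 1) b := by
  have h (α : Fin n → ZMod 2) := hf.hasExpMul α (fun _ => -(k : ℤ)) a b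
  have h' (α : Fin n → ZMod 2) : (support fun r : (Fin n → ℤ) × (Fin n → ℤ) =>
      (-1 : ℂ) ^ hammingNorm α • iotaPow α (fun _ => -(k : ℤ)) r.1 r.2 •
        f (a - r.1) (b - r.2)).Finite :=
    (h α).subset (support_const_smul_subset _ _)
  simp only [expMul, smul_finsum' _ (h _)]
  rw [← finsum_sum_comm _ _ fun α _ => h' α]
  simp only [smul_smul, ← Finset.sum_smul, sum_neg_one_pow_mul_iotaPow]
  -- Only pairs of sum -k contribute; they are parametrised by the exponent `a'` of x in `f`.
  rw [finsum_eq_finsum_comp (j := fun a' => (a - a', (fun _ => -(k : ℤ)) - a + a')),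
    taylor_shiftMul_left]
  · refine finsum_congr fun a' => ?_
    -- The binomial of the delta derivative is the one that expands x^(-a-1) x^(a') at x = y + z.
    rw [if_pos (by simp), show -(a - a') - 1 = a' + (-a - 1) by abel]
    congr 1
    simp only [sub_sub_cancel]
    congr 1
    ext i
    simp only [Pi.sub_apply, Pi.add_apply, Pi.neg_apply, Pi.one_apply]
    ring
  · intro a' a'' e
    simpa using congrArg Prod.fst e
  · intro r hr
    have : r.1 + r.2 = fun _ => -(k : ℤ) := by
      by_contra h
      exact hr (by simp [h])
    exact ⟨a - r.1, by simp [← this]⟩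

end

/-! ### Locality and the products ψ_m φ in terms of diagonal expansions -/

lemma mulPow_apply {k : ℕ} {L : List (Fin n)} (hL : listDeg L = fun _ => (k : ℤ))
    (F : OpSeries₂ n W) (a b : Fin n → ℤ) (w : W) :
    mulPow k F a b w = diffProd L (fun a b => F a b w) a b := by
  rw [mulPow, ← hL, mulSeries_apply fun w => hasExpMul_listDeg _ L, expMul_listDeg]

lemma exists_listDeg_eq_const (k : ℕ) : ∃ L : List (Fin n), listDeg L = fun _ => (k : ℤ) :=
  exists_listDeg_eq fun _ => Int.natCast_nonneg k

/-- Padding a list makes its multidegree exceed `κ` by a constant, as is needed to pass from lists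
to a uniform power (x - y)^k, possibly on top of (x - y)^κ with negative entries. -/
lemma exists_append_listDeg_eq_const (L : List (Fin n)) (κ : Fin n → ℤ) :
    ∃ (L' : List (Fin n)) (k : ℕ), listDeg (L' ++ L) = κ + fun _ => (k : ℤ) := by
  obtain ⟨M, hM⟩ := exists_forall_ge (listDeg L - κ)
  obtain ⟨L', hL'⟩ := exists_listDeg_eq (κ := κ + (fun _ => (M.toNat : ℤ)) - listDeg L) (by
    intro i
    have := hM i
    simp only [Pi.add_apply, Pi.sub_apply, Pi.zero_apply] at this ⊢
    lia)
  exact ⟨L', M.toNat, by simp [listDeg_append, hL']⟩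

lemma mutuallyLocal_iff {ψ φ : OpSeries n W} : MutuallyLocal ψ φ ↔
    ∃ L : List (Fin n), ∀ w,
      diffProd L (fun a b => ψ a (φ b w)) = diffProd L fun a b => φ b (ψ a w) := by
  constructor
  · rintro ⟨k, hk⟩
    obtain ⟨L, hL⟩ := exists_listDeg_eq_const (n := n) k
    refine ⟨L, fun w => ?_⟩
    ext a b
    have := LinearMap.congr_fun (congrFun (congrFun hk a) b) w
    rwa [mulPow_apply hL, mulPow_apply hL] at this
  · rintro ⟨L, hL⟩
    obtain ⟨L', k, h⟩ := exists_append_listDeg_eq_const L 0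
    rw [zero_add] at h
    refine ⟨k, ?_⟩
    ext a b w
    rw [mulPow_apply h, mulPow_apply h, diffProd_append, diffProd_append]
    exact congrFun (congrFun (congrArg _ (hL w)) a) b

lemma clears_iff {k : ℕ} {L : List (Fin n)} (hL : listDeg L = fun _ => (k : ℤ))
    (F : OpSeries₂ n W) :
    Clears k F ↔ ∀ w, LowerTruncated₂ (diffProd L fun a b => F a b w) := by
  simp only [Clears, mulPow_apply hL]

lemma truncatedRight_of_mem_VO {φ : OpSeries n W} (hφ : φ ∈ VO n W) (ψ : OpSeries n W) (w : W) :
    TruncatedRight fun a b => ψ a (φ b w) := by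
  obtain ⟨N, hN⟩ := hφ w
  refine ⟨N, fun a b h => ?_⟩
  have := hN b h
  simp only at this
  simp [this]

lemma truncatedLeft_of_mem_VO {ψ : OpSeries n W} (hψ : ψ ∈ VO n W) (φ : OpSeries n W) (w : W) :
    TruncatedLeft fun a b => φ b (ψ a w) := by
  obtain ⟨N, hN⟩ := hψ w
  refine ⟨N, fun a b h => ?_⟩
  have := hN a h
  simp only at this
  simp [this]

/-- ψ(x)φ(y)w is truncated in y and φ(y)ψ(x)w in x; once the factors of `L` make them equal, both
bounds hold. The list does not depend on `w`. -/
lemma MutuallyLocal.exists_lowerTruncated₂ {ψ φ : OpSeries n W} (h : MutuallyLocal ψ φ)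
    (hψ : ψ ∈ VO n W) (hφ : φ ∈ VO n W) :
    ∃ L : List (Fin n), ∀ w, LowerTruncated₂ (diffProd L fun a b => ψ a (φ b w)) := by
  obtain ⟨L, hL⟩ := mutuallyLocal_iff.1 h
  refine ⟨L, fun w => lowerTruncated₂_iff.2 ⟨?_, (truncatedRight_of_mem_VO hφ ψ w).diffProd L⟩⟩
  rw [hL]
  exact (truncatedLeft_of_mem_VO hψ φ w).diffProd L

lemma MutuallyLocal.clearable {ψ φ : OpSeries n W} (h : MutuallyLocal ψ φ)
    (hψ : ψ ∈ VO n W) (hφ : φ ∈ VO n W) (w : W) : Clearable fun a b => ψ a (φ b w) := by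
  obtain ⟨L, hL⟩ := h.exists_lowerTruncated₂ hψ hφ
  exact ⟨L, hL w⟩

/-- With (x - y)^m f cleared by (x - y)^k, the sum over α only concerns the expansions of (x -
y)^(-k), and `sum_expMul` turns it into a Taylor coefficient with exponent k - 1. Undoing the factor
of degree k + m lowers this to -m - 1. -/
lemma iotaSum_apply {ψ φ : OpSeries n W} (h : MutuallyLocal ψ φ) (hψ : ψ ∈ VO n W)
    (hφ : φ ∈ VO n W) (m a b : Fin n → ℤ) (w : W) :
    iotaSum m ψ φ a b w =
      diagExp (shiftMul (-a - 1) 0 fun a b => ψ a (φ b w)) (-m - 1) b := by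
  obtain ⟨L, hL⟩ := h.exists_lowerTruncated₂ hψ hφ
  have hexp (w : W) : HasExpMul 0 m fun a b => ψ a (φ b w) :=
    (truncatedRight_of_mem_VO hφ ψ w).hasExpMul m
  have hF : (fun w a b => mulSeries (iotaPow 0 m) (prodXY ψ φ) a b w) =
      fun w => expMul 0 m fun a b => ψ a (φ b w) := by
    ext w a b
    exact mulSeries_apply hexp a b w
  have hclears : ∃ k, Clears k (mulSeries (iotaPow 0 m) (prodXY ψ φ)) := by
    obtain ⟨L', k, hk⟩ := exists_append_listDeg_eq_const L m
    obtain ⟨K, hK⟩ := exists_listDeg_eq_const (n := n) k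
    refine ⟨k, (clears_iff hK _).2 fun w => ?_⟩
    rw [congrFun hF w, ← expMul_listDeg_add (hexp w), hK, add_comm, ← hk, expMul_listDeg,
      diffProd_append]
    exact (hL w).diffProd L'
  have hiota (α : Fin n → ZMod 2) : iota α (mulSeries (iotaPow 0 m) (prodXY ψ φ)) =
      mulSeries (iotaPow α fun _ => -(hclears.choose : ℤ))
        (mulPow hclears.choose (mulSeries (iotaPow 0 m) (prodXY ψ φ))) := dif_pos hclears
  have hk := hclears.choose_spec
  set k := hclears.choose
  obtain ⟨K, hK⟩ := exists_listDeg_eq_const (n := n) k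
  have hA (w : W) : (fun a b => mulPow k (mulSeries (iotaPow 0 m) (prodXY ψ φ)) a b w) =
      diffProd K (expMul 0 m fun a b => ψ a (φ b w)) := by
    ext a b
    rw [mulPow_apply hK, congrFun hF w]
  have hA' (w : W) : LowerTruncated₂ (diffProd K (expMul 0 m fun a b => ψ a (φ b w))) :=
    hA w ▸ hk w
  have hsum : iotaSum m ψ φ a b w = ∑ α : Fin n → ZMod 2, (-1 : ℂ) ^ hammingNorm α •
      expMul α (fun _ => -(k : ℤ)) (diffProd K (expMul 0 m fun a b => ψ a (φ b w))) a b := by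
    rw [iotaSum]
    simp only [Finset.sum_apply, LinearMap.sum_apply, hiota]
    refine Finset.sum_congr rfl fun α _ => ?_
    rw [Pi.smul_apply, Pi.smul_apply, LinearMap.smul_apply]
    rw [mulSeries_apply, hA]
    intro w
    rw [hA]
    exact (hA' w).hasExpMul _ _
  rw [hsum, sum_expMul (hA' w)]
  -- The exponent k + m may have negative entries, so it need not come from a list. The extra factor
  -- `R` makes it nonnegative, and `Q` is a list of the resulting multidegree.
  obtain ⟨M, hM⟩ := exists_forall_le m
  obtain ⟨R, hR⟩ := exists_listDeg_eq_const (n := n) (-M).toNat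
  obtain ⟨Q, hQ⟩ := exists_listDeg_eq (κ := listDeg (R ++ K) + m) (by
    intro i
    have := hM i
    simp only [listDeg_append, hR, hK, Pi.add_apply, Pi.zero_apply]
    lia)
  have hQ' : diffProd R (diffProd K (expMul 0 m fun a b => ψ a (φ b w))) =
      diffProd Q fun a b => ψ a (φ b w) := by
    rw [← diffProd_append, ← expMul_listDeg_add (hexp w), ← hQ, expMul_listDeg]
  rw [diagExp_eq (L := Q), diffProd_shiftMul, ← hQ', ← diffProd_shiftMul _ _ R,
    ← taylor_diffProd ((hA' w).shiftMul _ _) R]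
  · congr 1
    rw [hQ, listDeg_append, hK]
    ext i
    simp only [Pi.sub_apply, Pi.add_apply, Pi.neg_apply, Pi.one_apply]
    ring
  · rw [diffProd_shiftMul, ← hQ']
    exact ((hA' w).diffProd R).shiftMul _ _

lemma shiftMul_zero (f : (Fin n → ℤ) → (Fin n → ℤ) → W) : shiftMul 0 0 f = f := by
  ext a b
  simp

lemma nthProd_apply {ψ φ : OpSeries n W} (h : MutuallyLocal ψ φ) (hψ : ψ ∈ VO n W)
    (hφ : φ ∈ VO n W) (m b : Fin n → ℤ) (w : W) :
    nthProd m ψ φ b w = diagExp (fun a b => ψ a (φ b w)) (-m - 1) b := by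
  rw [nthProd, iotaSum_apply h hψ hφ, show -(fun _ => (-1 : ℤ)) - (1 : Fin n → ℤ) = 0 by ext; simp,
    shiftMul_zero]
end

section

variable {n : ℕ} {W : Type*} [AddCommGroup W] [Module ℂ W]

/-! ### Series in three sets of variables -/

lemma diagExp_shiftMul_unitVec {f : (Fin n → ℤ) → (Fin n → ℤ) → W} (hf : Clearable f) (i : Fin n)
    (c b : Fin n → ℤ) : diagExp (shiftMul (unitVec i) 0 f) c b =
      diagExp f (c - unitVec i) b + diagExp f c (b - unitVec i) := by
  rw [← diagExp_diffMul hf, ← diagExp_shiftMul_right hf,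
    ← diagExp_add (hf.diffMul i) (hf.shiftMul _ _), diffMul, LinearMap.sub_apply, sub_add_cancel]

/-- Multiplication by `x₁ ^ g₁ x₂ ^ g₂ y ^ h`. -/
def shiftMul₃ (g₁ g₂ h : Fin n → ℤ) :
    Module.End ℂ ((Fin n → ℤ) → (Fin n → ℤ) → (Fin n → ℤ) → W) where
  toFun F a₁ a₂ b := F (a₁ - g₁) (a₂ - g₂) (b - h)
  map_add' _ _ := rfl
  map_smul' _ _ := rfl

lemma commute_shiftMul₃ (g₁ g₂ h g₁' g₂' h' : Fin n → ℤ) :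
    Commute (shiftMul₃ (W := W) g₁ g₂ h) (shiftMul₃ g₁' g₂' h') := by
  ext F a₁ a₂ b
  simp [shiftMul₃, sub_right_comm]

/-- Multiplication by the product over a list of indices of the differences of the first and of the
second variables. -/
def diffProd₁₂ (L : List (Fin n)) : Module.End ℂ ((Fin n → ℤ) → (Fin n → ℤ) → (Fin n → ℤ) → W) :=
  (L.map fun i => shiftMul₃ (unitVec i) 0 0 - shiftMul₃ 0 (unitVec i) 0).prod

/-- Multiplication by the product over a list of indices of the differences of the first and of the
third variables. -/
def diffProd₁₃ (L : List (Fin n)) : Module.End ℂ ((Fin n → ℤ) → (Fin n → ℤ) → (Fin n → ℤ) → W) :=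
  (L.map fun i => shiftMul₃ (unitVec i) 0 0 - shiftMul₃ 0 0 (unitVec i)).prod

/-- Multiplication by the product over a list of indices of the differences of the second and of the
third variables. -/
def diffProd₂₃ (L : List (Fin n)) : Module.End ℂ ((Fin n → ℤ) → (Fin n → ℤ) → (Fin n → ℤ) → W) :=
  (L.map fun i => shiftMul₃ 0 (unitVec i) 0 - shiftMul₃ 0 0 (unitVec i)).prod

section

variable (F : (Fin n → ℤ) → (Fin n → ℤ) → (Fin n → ℤ) → W)

lemma diffProd₁₂_apply (L : List (Fin n)) (a₁ a₂ b : Fin n → ℤ) :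
    diffProd₁₂ L F a₁ a₂ b = diffProd L (fun a₁ a₂ => F a₁ a₂ b) a₁ a₂ := by
  induction L generalizing a₁ a₂ with
  | nil => rfl
  | cons i L ih =>
    rw [diffProd_cons, diffMul_apply, ← ih, ← ih]
    simp [diffProd₁₂, shiftMul₃]

lemma diffProd₁₃_apply (L : List (Fin n)) (a₁ a₂ b : Fin n → ℤ) :
    diffProd₁₃ L F a₁ a₂ b = diffProd L (fun a₁ b => F a₁ a₂ b) a₁ b := by
  induction L generalizing a₁ b with
  | nil => rfl
  | cons i L ih =>
    rw [diffProd_cons, diffMul_apply, ← ih, ← ih]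
    simp [diffProd₁₃, shiftMul₃]

lemma diffProd₂₃_apply (L : List (Fin n)) (a₁ : Fin n → ℤ) :
    diffProd₂₃ L F a₁ = diffProd L (F a₁) := by
  induction L with
  | nil => rfl
  | cons i L ih =>
    ext a₂ b
    rw [diffProd_cons, diffMul_apply, ← ih]
    simp [diffProd₂₃, shiftMul₃]

lemma diffProd₁₂_singleton (i : Fin n) (a₁ : Fin n → ℤ) :
    diffProd₁₂ [i] F a₁ = F (a₁ - unitVec i) - shiftMul (unitVec i) 0 (F a₁) := by
  ext a₂ b
  simp [diffProd₁₂_apply, diffProd_cons, diffMul_apply]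

lemma diffProd₁₃_singleton (i : Fin n) (a₁ : Fin n → ℤ) :
    diffProd₁₃ [i] F a₁ = F (a₁ - unitVec i) - shiftMul 0 (unitVec i) (F a₁) := by
  ext a₂ b
  simp [diffProd₁₃_apply, diffProd_cons, diffMul_apply]

lemma diffProd₂₃_singleton (i : Fin n) (a₁ : Fin n → ℤ) :
    diffProd₂₃ [i] F a₁ = diffMul i (F a₁) := by
  rw [diffProd₂₃_apply, diffProd_cons, diffProd_nil]

lemma diffProd₁₂_append (L L' : List (Fin n)) :
    diffProd₁₂ (L ++ L') F = diffProd₁₂ L (diffProd₁₂ L' F) := by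
  simp [diffProd₁₂]

lemma diffProd₁₃_append (L L' : List (Fin n)) :
    diffProd₁₃ (L ++ L') F = diffProd₁₃ L (diffProd₁₃ L' F) := by
  simp [diffProd₁₃]

lemma diffProd₂₃_append (L L' : List (Fin n)) :
    diffProd₂₃ (L ++ L') F = diffProd₂₃ L (diffProd₂₃ L' F) := by
  simp [diffProd₂₃]

lemma commute_prod_map_of_commute {M ι : Type*} [Monoid M] {x y : ι → M}
    (h : ∀ i j, Commute (x i) (y j)) (L L' : List ι) : Commute (L.map x).prod (L'.map y).prod := by
  refine Commute.list_prod_left _ _ fun a ha => Commute.list_prod_right _ _ fun b hb => ?_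
  obtain ⟨i, -, rfl⟩ := List.mem_map.1 ha
  obtain ⟨j, -, rfl⟩ := List.mem_map.1 hb
  exact h i j

lemma commute_shiftMul₃_sub (g₁ g₂ g₃ h₁ h₂ h₃ g₁' g₂' g₃' h₁' h₂' h₃' : Fin n → ℤ) :
    Commute (shiftMul₃ (W := W) g₁ g₂ g₃ - shiftMul₃ h₁ h₂ h₃)
      (shiftMul₃ g₁' g₂' g₃' - shiftMul₃ h₁' h₂' h₃') :=
  ((commute_shiftMul₃ _ _ _ _ _ _).sub_right (commute_shiftMul₃ _ _ _ _ _ _)).sub_left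
    ((commute_shiftMul₃ _ _ _ _ _ _).sub_right (commute_shiftMul₃ _ _ _ _ _ _))

lemma diffProd₁₂_diffProd₁₃ (L L' : List (Fin n)) :
    diffProd₁₂ L (diffProd₁₃ L' F) = diffProd₁₃ L' (diffProd₁₂ L F) :=
  LinearMap.congr_fun
    (commute_prod_map_of_commute (fun _ _ => commute_shiftMul₃_sub _ _ _ _ _ _ _ _ _ _ _ _) L L').eq F

lemma diffProd₁₂_diffProd₂₃ (L L' : List (Fin n)) :
    diffProd₁₂ L (diffProd₂₃ L' F) = diffProd₂₃ L' (diffProd₁₂ L F) :=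
  LinearMap.congr_fun
    (commute_prod_map_of_commute (fun _ _ => commute_shiftMul₃_sub _ _ _ _ _ _ _ _ _ _ _ _) L L').eq F

lemma diffProd₁₃_diffProd₂₃ (L L' : List (Fin n)) :
    diffProd₁₃ L (diffProd₂₃ L' F) = diffProd₂₃ L' (diffProd₁₃ L F) :=
  LinearMap.congr_fun
    (commute_prod_map_of_commute (fun _ _ => commute_shiftMul₃_sub _ _ _ _ _ _ _ _ _ _ _ _) L L').eq F

end

/-! ### Diagonal expansions in the last two sets of variables -/

section

variable {F : (Fin n → ℤ) → (Fin n → ℤ) → (Fin n → ℤ) → W}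

/-- At x₂ = y + z one has x₁ - x₂ = (x₁ - y) - z. -/
lemma diagExp_diffProd₁₂_singleton (hF : ∀ a₁, Clearable (F a₁)) (i : Fin n) (c : Fin n → ℤ) :
    (fun a₁ b => diagExp (diffProd₁₂ [i] F a₁) c b) =
      diffMul i (fun a₁ b => diagExp (F a₁) c b) -
        fun a₁ b => diagExp (F a₁) (c - unitVec i) b := by
  ext a₁ b
  simp only [diffProd₁₂_singleton, Pi.sub_apply, diffMul_apply]
  rw [diagExp_sub (hF _) ((hF _).shiftMul _ _), diagExp_shiftMul_unitVec (hF _)]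
  abel

lemma diagExp_diffProd₁₃_singleton (hF : ∀ a₁, Clearable (F a₁)) (i : Fin n) (c : Fin n → ℤ) :
    (fun a₁ b => diagExp (diffProd₁₃ [i] F a₁) c b) =
      diffMul i (fun a₁ b => diagExp (F a₁) c b) := by
  ext a₁ b
  simp only [diffProd₁₃_singleton, diffMul_apply]
  rw [diagExp_sub (hF _) ((hF _).shiftMul _ _), diagExp_shiftMul_right (hF _)]

lemma clearable_diffProd₁₃ (hF : ∀ a₁, Clearable (F a₁)) (L : List (Fin n)) (a₁ : Fin n → ℤ) :
    Clearable (diffProd₁₃ L F a₁) := by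
  induction L generalizing a₁ with
  | nil => exact hF a₁
  | cons i L ih =>
    rw [← List.singleton_append, diffProd₁₃_append, diffProd₁₃_singleton]
    exact (ih _).sub ((ih _).shiftMul _ _)

lemma diagExp_diffProd₁₃ (hF : ∀ a₁, Clearable (F a₁)) (L : List (Fin n)) (c : Fin n → ℤ) :
    (fun a₁ b => diagExp (diffProd₁₃ L F a₁) c b) =
      diffProd L (fun a₁ b => diagExp (F a₁) c b) := by
  induction L with
  | nil => rfl
  | cons i L ih =>
    rw [← List.singleton_append, diffProd₁₃_append,
      diagExp_diffProd₁₃_singleton (clearable_diffProd₁₃ hF L), ih, List.singleton_append,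
      diffProd_cons]

lemma lowerTruncated₂_diffProd₁₂ {K : List (Fin n)}
    (hF : ∀ a₁, LowerTruncated₂ (diffProd K (F a₁))) (i : Fin n) (a₁ : Fin n → ℤ) :
    LowerTruncated₂ (diffProd K (diffProd₁₂ [i] F a₁)) := by
  rw [diffProd₁₂_singleton, map_sub, diffProd_shiftMul]
  exact (hF _).sub ((hF _).shiftMul _ _)

lemma lowerTruncated₂_diffProd₁₃ {K : List (Fin n)}
    (hF : ∀ a₁, LowerTruncated₂ (diffProd K (F a₁))) (L : List (Fin n)) (a₁ : Fin n → ℤ) :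
    LowerTruncated₂ (diffProd K (diffProd₁₃ L F a₁)) := by
  induction L generalizing a₁ with
  | nil => exact hF a₁
  | cons i L ih =>
    rw [← List.singleton_append, diffProd₁₃_append, diffProd₁₃_singleton, map_sub,
      diffProd_shiftMul]
    exact (ih _).sub ((ih _).shiftMul _ _)

end

/-- If `F(x₁, x₂, y)` is killed by a power of `x₁ - x₂`, then the coefficients of its expansion
along `x₂ = y` are killed by powers of `x₁ - y`. -/
lemma exists_diffProd_diagExp_eq_zero_of_diffProd₁₂ (K L : List (Fin n)) (c : Fin n → ℤ) :
    ∃ L' : List (Fin n), ∀ F : (Fin n → ℤ) → (Fin n → ℤ) → (Fin n → ℤ) → W,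
      (∀ a₁, LowerTruncated₂ (diffProd K (F a₁))) → diffProd₁₂ L F = 0 →
        (diffProd L' fun a₁ b => diagExp (F a₁) c b) = 0 := by
  induction L generalizing c with
  | nil =>
    refine ⟨[], fun F _ hF => ?_⟩
    obtain rfl : F = 0 := hF
    ext a₁ b
    exact diagExp_zero c b
  | cons i L ih =>
    -- `N` bounds the distance of `c i` from the lowest power of zᵢ that the clearing list `K`
    -- allows.
    obtain ⟨N, hN⟩ : ∃ N : ℕ, c i + listDeg K i < N :=
      ⟨(c i + listDeg K i + 1).toNat, by lia⟩
    induction N generalizing c with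
    | zero =>
      refine ⟨[], fun F hK _ => ?_⟩
      ext a₁ b
      exact diagExp_of_lt (hK a₁) b (by simpa using hN)
    | succ N ihN =>
      obtain ⟨L₁, h₁⟩ := ih c
      obtain ⟨L₂, h₂⟩ := ihN (c - unitVec i) (by
        simp only [Pi.sub_apply, Pi.single_eq_same]
        push_cast at hN
        lia)
      -- The `i`-th factor x₁ - y turns the coefficient at `c` into that of the `i`-th x₁ - x₂ times
      -- `F`, killed by `L₁`, plus the coefficient of `F` at `c - unitVec i`, killed by `L₂`. Both
      -- lists are independent of `F`, as one power must serve all vectors.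
      refine ⟨L₁ ++ L₂ ++ [i], fun F hK hF => ?_⟩
      have h := diagExp_diffProd₁₂_singleton (fun a₁ => ⟨K, hK a₁⟩) i c
      rw [diffProd_append, diffProd_cons, diffProd_nil, ← sub_add_cancel
        (diffMul i fun a₁ b => diagExp (F a₁) c b), ← h, map_add, diffProd_append, diffProd_append,
        h₂ F hK hF, map_zero, add_zero, diffProd_comm, h₁ _ (lowerTruncated₂_diffProd₁₂ hK i),
        map_zero]
      rw [← hF, ← List.singleton_append, diffProd₁₂_append]
      exact LinearMap.congr_fun
        (commute_prod_map_of_commute (fun _ _ => commute_shiftMul₃_sub _ _ _ _ _ _ _ _ _ _ _ _)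
          L [i]).eq F

lemma exists_diffProd_diagExp_eq_zero (K L₁ L₂ : List (Fin n)) (c : Fin n → ℤ) :
    ∃ L' : List (Fin n), ∀ F : (Fin n → ℤ) → (Fin n → ℤ) → (Fin n → ℤ) → W,
      (∀ a₁, LowerTruncated₂ (diffProd K (F a₁))) → diffProd₁₂ L₁ (diffProd₁₃ L₂ F) = 0 →
        (diffProd L' fun a₁ b => diagExp (F a₁) c b) = 0 := by
  obtain ⟨L', h⟩ := exists_diffProd_diagExp_eq_zero_of_diffProd₁₂ (W := W) K L₁ c
  refine ⟨L' ++ L₂, fun F hK hF => ?_⟩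
  rw [diffProd_append, ← diagExp_diffProd₁₃ fun a₁ => ⟨K, hK a₁⟩]
  exact h _ (lowerTruncated₂_diffProd₁₃ hK L₂) hF

/-! ### Local sets of vertex operators -/

lemma MutuallyLocal.symm {ψ φ : OpSeries n W} (h : MutuallyLocal ψ φ) : MutuallyLocal φ ψ := by
  rw [mutuallyLocal_iff] at h ⊢
  obtain ⟨L, hL⟩ := h
  refine ⟨L, fun w => ?_⟩
  ext a b
  rw [diffProd_swap L fun a b => φ b (ψ a w), diffProd_swap L fun a b => ψ a (φ b w), hL]

lemma idOp_apply (m : Fin n → ℤ) (w : W) : idOp n W m w = if m = 0 then w else 0 := by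
  by_cases h : m = 0
  · simp [idOp, h]
  · simp [idOp, h]

lemma mutuallyLocal_idOp (ψ : OpSeries n W) : MutuallyLocal ψ (idOp n W) := by
  refine mutuallyLocal_iff.2 ⟨[], fun w => ?_⟩
  ext a b
  simp only [diffProd_nil, idOp_apply]
  split_ifs <;> simp

lemma idOp_mem_VO : idOp n W ∈ VO n W := by
  refine fun w => ⟨0, fun m ⟨i, hi⟩ => ?_⟩
  simp only [idOp_apply]
  rw [if_neg]
  rintro rfl
  exact lt_irrefl _ hi

lemma MutuallyLocal.add {θ ψ φ : OpSeries n W} (hψ : MutuallyLocal θ ψ) (hφ : MutuallyLocal θ φ) :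
    MutuallyLocal θ (ψ + φ) := by
  rw [mutuallyLocal_iff] at hψ hφ ⊢
  obtain ⟨L, hL⟩ := hψ
  obtain ⟨L', hL'⟩ := hφ
  refine ⟨L ++ L', fun w => ?_⟩
  have h₁ : (fun a b => θ a ((ψ + φ) b w)) = (fun a b => θ a (ψ b w)) + fun a b => θ a (φ b w) := by
    ext a b
    simp
  have h₂ : (fun a b => (ψ + φ) b (θ a w)) = (fun a b => ψ b (θ a w)) + fun a b => φ b (θ a w) := by
    ext a b
    simp
  rw [h₁, h₂, map_add, map_add, diffProd_append, diffProd_append, diffProd_append, diffProd_append,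
    hL', diffProd_comm L, hL, diffProd_comm L' L]

lemma MutuallyLocal.smul {θ ψ : OpSeries n W} (h : MutuallyLocal θ ψ) (c : ℂ) :
    MutuallyLocal θ (c • ψ) := by
  rw [mutuallyLocal_iff] at h ⊢
  obtain ⟨L, hL⟩ := h
  refine ⟨L, fun w => ?_⟩
  have h₁ : (fun a b => θ a ((c • ψ) b w)) = c • fun a b => θ a (ψ b w) := by
    ext a b
    simp
  have h₂ : (fun a b => (c • ψ) b (θ a w)) = c • fun a b => ψ b (θ a w) := by
    ext a b
    simp
  rw [h₁, h₂, map_smul, map_smul, hL]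

lemma mutuallyLocal_zero (θ : OpSeries n W) : MutuallyLocal θ 0 :=
  mutuallyLocal_iff.2 ⟨[], fun w => by simp⟩

lemma nthProd_mem_VO {ψ φ : OpSeries n W} (h : MutuallyLocal ψ φ) (hψ : ψ ∈ VO n W)
    (hφ : φ ∈ VO n W) (m : Fin n → ℤ) : nthProd m ψ φ ∈ VO n W := by
  intro w
  simp only [nthProd_apply h hψ hφ]
  exact lowerTruncated_diagExp (h.clearable hψ hφ w) _

/-- Dong's lemma. -/
lemma MutuallyLocal.nthProd {θ ψ φ : OpSeries n W} (hθψ : MutuallyLocal θ ψ)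
    (hθφ : MutuallyLocal θ φ) (h : MutuallyLocal ψ φ) (hψ : ψ ∈ VO n W) (hφ : φ ∈ VO n W)
    (m : Fin n → ℤ) : MutuallyLocal θ (nthProd m ψ φ) := by
  obtain ⟨L₁, hL₁⟩ := mutuallyLocal_iff.1 hθψ
  obtain ⟨L₂, hL₂⟩ := mutuallyLocal_iff.1 hθφ
  obtain ⟨K, hK⟩ := h.exists_lowerTruncated₂ hψ hφ
  obtain ⟨L, hL⟩ := exists_diffProd_diagExp_eq_zero (W := W) K L₁ L₂ (-m - 1)
  refine mutuallyLocal_iff.2 ⟨L, fun w => sub_eq_zero.1 ?_⟩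
  -- `K` clears ψφ on every vector, so it serves both `w` and all the vectors `θ a₁ w`.
  have h₁ (a₁ : Fin n → ℤ) :
      LowerTruncated₂ (diffProd K fun a₂ b => θ a₁ (ψ a₂ (φ b w))) := by
    rw [diffProd_map]
    exact (hK w).map _
  have h₂ (a₁ : Fin n → ℤ) := hK (θ a₁ w)
  rw [← map_sub, ← hL (fun a₁ => (fun a₂ b => θ a₁ (ψ a₂ (φ b w))) - fun a₂ b => ψ a₂ (φ b (θ a₁ w)))]
  · congr 1
    ext a₁ b
    rw [diagExp_sub ⟨K, h₁ a₁⟩ ⟨K, h₂ a₁⟩, Pi.sub_apply, Pi.sub_apply, nthProd_apply h hψ hφ,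
      nthProd_apply h hψ hφ, diagExp_map (θ a₁) ⟨K, hK w⟩]
  · intro a₁
    rw [map_sub]
    exact (h₁ a₁).sub (h₂ a₁)
  -- θ is moved to the right, past ψ at the cost of `L₁` and past φ at the cost of `L₂`.
  · have e₁ : diffProd₁₂ L₁ (fun a₁ a₂ b => θ a₁ (ψ a₂ (φ b w))) =
        diffProd₁₂ L₁ fun a₁ a₂ b => ψ a₂ (θ a₁ (φ b w)) := by
      ext a₁ a₂ b
      rw [diffProd₁₂_apply, diffProd₁₂_apply, hL₁]
    have e₂ : diffProd₁₃ L₂ (fun a₁ a₂ b => ψ a₂ (θ a₁ (φ b w))) =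
        diffProd₁₃ L₂ fun a₁ a₂ b => ψ a₂ (φ b (θ a₁ w)) := by
      ext a₁ a₂ b
      rw [diffProd₁₃_apply, diffProd₁₃_apply, diffProd_map, diffProd_map, hL₂]
    rw [diffProd₁₂_diffProd₁₃]
    change diffProd₁₃ L₂ (diffProd₁₂ L₁ ((fun a₁ a₂ b => θ a₁ (ψ a₂ (φ b w))) -
      fun a₁ a₂ b => ψ a₂ (φ b (θ a₁ w)))) = 0
    rw [map_sub, map_sub, e₁, ← diffProd₁₂_diffProd₁₃, e₂, ← diffProd₁₂_diffProd₁₃, sub_self]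

/-! ### Maximal local sets and the generated subspace -/

lemma IsLocalSet.insert {T : Set (OpSeries n W)} (hT : IsLocalSet T) {χ : OpSeries n W}
    (hχ : χ ∈ VO n W) (hχχ : MutuallyLocal χ χ) (h : ∀ ψ ∈ T, MutuallyLocal ψ χ) :
    IsLocalSet (insert χ T) := by
  refine ⟨Set.insert_subset hχ hT.1, ?_⟩
  rintro ψ (rfl | hψ) φ (rfl | hφ)
  · exact hχχ
  · exact (h φ hφ).symm
  · exact h ψ hψ
  · exact hT.2 ψ hψ φ hφ

lemma IsLocalSet.mono {S T : Set (OpSeries n W)} (hT : IsLocalSet T) (h : S ⊆ T) : IsLocalSet S :=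
  ⟨h.trans hT.1, fun ψ hψ φ hφ => hT.2 ψ (h hψ) φ (h hφ)⟩

/-- A maximal local set is a closed local subspace that contains `1`. -/
lemma exists_isClosedLocal {S : Set (OpSeries n W)} (hS : IsLocalSet S) :
    ∃ V : Submodule ℂ (OpSeries n W), IsClosedLocal V ∧ S ⊆ V ∧ idOp n W ∈ V := by
  obtain ⟨T, hST, hT⟩ := zorn_subset_nonempty {T : Set (OpSeries n W) | IsLocalSet T}
    (fun c hc hchain _ => ⟨⋃₀ c, ⟨Set.sUnion_subset fun T hT => (hc hT).1, by
      rintro ψ ⟨T, hT, hψ⟩ φ ⟨T', hT', hφ⟩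
      rcases hchain.total hT hT' with h | h
      · exact (hc hT').2 ψ (h hψ) φ hφ
      · exact (hc hT).2 ψ hψ φ (h hφ)⟩, fun T hT => Set.subset_sUnion_of_mem hT⟩) S hS
  have hloc : IsLocalSet T := hT.prop
  -- Maximality: whatever is local with itself and with all of `T` is already in `T`.
  have key {χ : OpSeries n W} (hχ : χ ∈ VO n W) (hχχ : MutuallyLocal χ χ)
      (h : ∀ ψ ∈ T, MutuallyLocal ψ χ) : χ ∈ T :=
    hT.le_of_ge (hloc.insert hχ hχχ h) (Set.subset_insert χ T) (Set.mem_insert χ T)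
  refine ⟨{ carrier := T, add_mem' := ?_, zero_mem' := ?_, smul_mem' := ?_ }, ⟨hloc, ?_⟩, hST, ?_⟩
  · intro ψ φ hψ hφ
    have h (θ) (hθ : θ ∈ T) : MutuallyLocal θ (ψ + φ) :=
      (hloc.2 θ hθ ψ hψ).add (hloc.2 θ hθ φ hφ)
    exact key (add_mem (hloc.1 hψ) (hloc.1 hφ)) ((h ψ hψ).symm.add (h φ hφ).symm) h
  · exact key (zero_mem _) (mutuallyLocal_zero 0) fun ψ _ => mutuallyLocal_zero ψ
  · intro c ψ hψ
    have h (θ) (hθ : θ ∈ T) : MutuallyLocal θ (c • ψ) := (hloc.2 θ hθ ψ hψ).smul c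
    exact key (Submodule.smul_mem _ c (hloc.1 hψ)) ((h ψ hψ).symm.smul c) h
  · intro ψ hψ φ hφ m
    have hψφ := hloc.2 ψ hψ φ hφ
    have h (θ) (hθ : θ ∈ T) : MutuallyLocal θ (nthProd m ψ φ) :=
      (hloc.2 θ hθ ψ hψ).nthProd (hloc.2 θ hθ φ hφ) hψφ (hloc.1 hψ) (hloc.1 hφ) m
    -- Self-locality is a second use of Dong's lemma, with θ the product itself: by the first use it
    -- is local with ψ and with φ.
    exact key (nthProd_mem_VO hψφ (hloc.1 hψ) (hloc.1 hφ) m)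
      ((h ψ hψ).symm.nthProd (h φ hφ).symm hψφ (hloc.1 hψ) (hloc.1 hφ) m) h
  · exact key idOp_mem_VO (mutuallyLocal_idOp _) fun ψ _ => mutuallyLocal_idOp ψ

/-- Closure under products passes to intersections and locality to subspaces, so a single member of
the family is enough to make the intersection local. -/
lemma isLeast_generatedBy {S : Set (OpSeries n W)} (hS : IsLocalSet S) :
    IsLeast {V : Submodule ℂ (OpSeries n W) | IsClosedLocal V ∧ S ⊆ V ∧ idOp n W ∈ V}
      (generatedBy S) := by
  obtain ⟨V₀, hV₀⟩ := exists_isClosedLocal hS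
  have hle : generatedBy S ≤ V₀ := sInf_le hV₀
  refine ⟨⟨⟨hV₀.1.1.mono hle, fun ψ hψ φ hφ m => ?_⟩, fun ψ hψ => ?_, ?_⟩, fun V hV => sInf_le hV⟩
  · simp only [generatedBy, Submodule.mem_sInf] at hψ hφ ⊢
    exact fun V hV => hV.1.2 ψ (hψ V hV) φ (hφ V hV) m
  · simp only [generatedBy, SetLike.mem_coe, Submodule.mem_sInf]
    exact fun V hV => hV.2.1 hψ
  · simp only [generatedBy, Submodule.mem_sInf]
    exact fun V hV => hV.2.2
end

section

variable {n : ℕ} {W : Type*} [AddCommGroup W] [Module ℂ W]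

/-! ### The Jacobi identity -/

/-- The Jacobi identity follows from its iterate form. -/
lemma jacobiIdentity_of_apply_apply {V : Type*} [AddCommGroup V] [Module ℂ V]
    {Y : V →ₗ[ℂ] OpSeries n V} {YW : V →ₗ[ℂ] OpSeries n W} (hVO : ∀ u, YW u ∈ VO n W)
    (hloc : ∀ u v, MutuallyLocal (YW u) (YW v))
    (h : ∀ (u v : V) (c b : Fin n → ℤ) (w : W),
      YW (Y u c v) b w = diagExp (fun a b => YW u a (YW v b w)) c b) : JacobiIdentity Y YW := by
  intro u v a b c
  obtain ⟨L, hL⟩ := (hloc u v).exists_lowerTruncated₂ (hVO u) (hVO v)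
  -- The delta function fixes `r.1` and forces `r.2 ≥ 0`; the pole order of the diagonal expansion
  -- bounds `r.2` above.
  have hmem {w : W} {r : (Fin n → ℤ) × (Fin n → ℤ)}
      (hr : deltaCoeff a r.1 r.2 • diagExp (fun a b => YW u a (YW v b w)) (c - r.2) (b - r.1) ≠ 0) :
      r.1 = -a - 1 - r.2 ∧ r.2 ∈ Finset.Icc 0 (c + listDeg L) := by
    rw [smul_ne_zero_iff, deltaCoeff_eq, ite_ne_right_iff] at hr
    obtain ⟨⟨hr₁, hr₂⟩, hr₃⟩ := hr
    refine ⟨?_, Finset.mem_Icc.2 ⟨fun i => ?_, fun i => ?_⟩⟩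
    · rw [eq_sub_iff_add_eq, eq_sub_iff_add_eq, ← add_eq_zero_iff_eq_neg, ← hr₁]
      abel
    · by_contra hi
      exact hr₂ (multiBinom_of_neg _ (not_le.1 hi))
    · by_contra hi
      refine hr₃ (diagExp_of_lt (hL w) _ (i := i) ?_)
      simp only [Pi.add_apply, Pi.sub_apply] at hi ⊢
      lia
  have hfin (w : W) : (support fun r : (Fin n → ℤ) × (Fin n → ℤ) =>
      (deltaCoeff a r.1 r.2 • YW (Y u (c - r.2) v) (b - r.1)) w).Finite := by
    refine ((Finset.Icc 0 (c + listDeg L)).finite_toSet.image fun q => (-a - 1 - q, q)).subset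
      fun r hr => ?_
    simp only [mem_support, LinearMap.smul_apply, h] at hr
    obtain ⟨h₁, h₂⟩ := hmem hr
    exact ⟨r.2, h₂, Prod.ext h₁.symm rfl⟩
  ext w
  rw [opSum_apply hfin, iotaSum_apply (hloc u v) (hVO u) (hVO v), diagExp_shiftMul (hL w)]
  simp only [LinearMap.smul_apply, h]
  rw [finsum_eq_finsum_comp (j := fun q => (-a - 1 - q, q))]
  · have hc : -(fun i => -c i - 1) - (1 : Fin n → ℤ) = c := by
      ext i
      simp
    rw [hc, finsum_eq_sum_of_support_subset (s := Finset.Icc 0 (c + listDeg L))]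
    · refine Finset.sum_congr rfl fun r _ => ?_
      rw [deltaCoeff_eq, if_pos (by ring), show b - (-a - 1 - r) = b - (-a - 1) + r by abel]
    · exact fun r hr => (hmem (r := (-a - 1 - r, r)) hr).2
  · exact fun q q' e => congrArg Prod.snd e
  · intro r hr
    exact ⟨r.2, Prod.ext (hmem hr).1.symm rfl⟩

/-! ### Nested and iterated diagonal expansions -/

/-- The expansion of `F(y + z₁, y + z₂, y)`, first in `z₂` and then in `z₁`. -/
noncomputable def nestedExp (F : (Fin n → ℤ) → (Fin n → ℤ) → (Fin n → ℤ) → W)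
    (c₁ c₂ b : Fin n → ℤ) : W :=
  diagExp (fun a₁ b => diagExp (F a₁) c₂ b) c₁ b

/-- The expansion of `F(x + z₁, x, y)` in `z₁`, followed by that for `x = y + z₂` in `z₂`. -/
noncomputable def iterExp (F : (Fin n → ℤ) → (Fin n → ℤ) → (Fin n → ℤ) → W)
    (c₁ c₂ b : Fin n → ℤ) : W :=
  diagExp (fun a₂ b => diagExp (fun a₁ a₂ => F a₁ a₂ b) c₁ a₂) c₂ b

/-- The expansion `nestedExp F` exists. -/
def NestedClearable (F : (Fin n → ℤ) → (Fin n → ℤ) → (Fin n → ℤ) → W) : Prop :=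
  (∀ a₁, Clearable (F a₁)) ∧ ∀ c, Clearable fun a₁ b => diagExp (F a₁) c b

/-- The expansion `iterExp F` exists. -/
def IterClearable (F : (Fin n → ℤ) → (Fin n → ℤ) → (Fin n → ℤ) → W) : Prop :=
  (∃ K : List (Fin n), ∀ b, LowerTruncated₂ (diffProd K fun a₁ a₂ => F a₁ a₂ b)) ∧
    ∀ c, Clearable fun a₂ b => diagExp (fun a₁ a₂ => F a₁ a₂ b) c a₂

section

variable {F G : (Fin n → ℤ) → (Fin n → ℤ) → (Fin n → ℤ) → W}

lemma NestedClearable.smul (hF : NestedClearable F) (r : ℂ) : NestedClearable (r • F) := by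
  refine ⟨fun a₁ => (hF.1 a₁).smul r, fun c => ?_⟩
  simp only [Pi.smul_apply, diagExp_smul r (hF.1 _)]
  exact (hF.2 c).smul r

lemma nestedExp_smul (hF : NestedClearable F) (r : ℂ) (c₁ c₂ b : Fin n → ℤ) :
    nestedExp (r • F) c₁ c₂ b = r • nestedExp F c₁ c₂ b := by
  simp only [nestedExp, Pi.smul_apply, diagExp_smul r (hF.1 _)]
  exact diagExp_smul r (hF.2 c₂) c₁ b

lemma NestedClearable.diffProd₁₂_singleton (hF : NestedClearable F) (i : Fin n) :
    NestedClearable (diffProd₁₂ [i] F) := by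
  refine ⟨fun a₁ => ?_, fun c => ?_⟩
  · rw [_root_.diffProd₁₂_singleton]
    exact (hF.1 _).sub ((hF.1 _).shiftMul _ _)
  · rw [diagExp_diffProd₁₂_singleton hF.1]
    exact ((hF.2 _).diffMul i).sub (hF.2 _)

/-- At x₁ = y + z₁, x₂ = y + z₂ the factor x₁ - x₂ becomes z₁ - z₂. -/
lemma nestedExp_diffProd₁₂_singleton (hF : NestedClearable F) (i : Fin n) (c₁ c₂ b : Fin n → ℤ) :
    nestedExp (diffProd₁₂ [i] F) c₁ c₂ b =
      nestedExp F (c₁ - unitVec i) c₂ b - nestedExp F c₁ (c₂ - unitVec i) b := by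
  rw [nestedExp, diagExp_diffProd₁₂_singleton hF.1, diagExp_sub ((hF.2 _).diffMul i) (hF.2 _),
    diagExp_diffMul (hF.2 _)]
  rfl

lemma NestedClearable.diffProd₁₂ (hF : NestedClearable F) (L : List (Fin n)) :
    NestedClearable (diffProd₁₂ L F) := by
  induction L with
  | nil => exact hF
  | cons i L ih =>
    rw [← List.singleton_append, diffProd₁₂_append]
    exact ih.diffProd₁₂_singleton i

lemma nestedExp_diffProd₁₂ (hF : NestedClearable F) (L : List (Fin n)) (c₁ c₂ b : Fin n → ℤ) :
    nestedExp (diffProd₁₂ L F) c₁ c₂ b =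
      diffProd L (fun c₁ c₂ => nestedExp F c₁ c₂ b) c₁ c₂ := by
  induction L generalizing c₁ c₂ with
  | nil => rfl
  | cons i L ih =>
    rw [← List.singleton_append, diffProd₁₂_append,
      nestedExp_diffProd₁₂_singleton (hF.diffProd₁₂ L), ih, ih, List.singleton_append,
      diffProd_cons, diffMul_apply]

lemma NestedClearable.diffProd₁₃_singleton (hF : NestedClearable F) (i : Fin n) :
    NestedClearable (diffProd₁₃ [i] F) := by
  refine ⟨clearable_diffProd₁₃ hF.1 [i], fun c => ?_⟩
  rw [diagExp_diffProd₁₃_singleton hF.1]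
  exact (hF.2 _).diffMul i

lemma nestedExp_diffProd₁₃_singleton (hF : NestedClearable F) (i : Fin n) (c₁ c₂ b : Fin n → ℤ) :
    nestedExp (diffProd₁₃ [i] F) c₁ c₂ b = nestedExp F (c₁ - unitVec i) c₂ b := by
  rw [nestedExp, diagExp_diffProd₁₃_singleton hF.1, diagExp_diffMul (hF.2 _)]
  rfl

lemma NestedClearable.diffProd₂₃_singleton (hF : NestedClearable F) (i : Fin n) :
    NestedClearable (diffProd₂₃ [i] F) := by
  refine ⟨fun a₁ => ?_, fun c => ?_⟩
  · rw [_root_.diffProd₂₃_singleton]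
    exact (hF.1 a₁).diffMul i
  · simp only [_root_.diffProd₂₃_singleton, diagExp_diffMul (hF.1 _)]
    exact hF.2 _

lemma nestedExp_diffProd₂₃_singleton (hF : NestedClearable F) (i : Fin n) (c₁ c₂ b : Fin n → ℤ) :
    nestedExp (diffProd₂₃ [i] F) c₁ c₂ b = nestedExp F c₁ (c₂ - unitVec i) b := by
  simp only [nestedExp, diffProd₂₃_singleton, diagExp_diffMul (hF.1 _)]

lemma diffProd₁₂_singleton_eq (F : (Fin n → ℤ) → (Fin n → ℤ) → (Fin n → ℤ) → W) (i : Fin n)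
    (b : Fin n → ℤ) :
    (fun a₁ a₂ => diffProd₁₂ [i] F a₁ a₂ b) = diffMul i fun a₁ a₂ => F a₁ a₂ b := by
  ext a₁ a₂
  rw [diffProd₁₂_apply, diffProd_cons, diffProd_nil]

lemma diffProd₂₃_singleton_eq (F : (Fin n → ℤ) → (Fin n → ℤ) → (Fin n → ℤ) → W) (i : Fin n)
    (b : Fin n → ℤ) : (fun a₁ a₂ => diffProd₂₃ [i] F a₁ a₂ b) =
      shiftMul 0 (unitVec i) (fun a₁ a₂ => F a₁ a₂ b) - fun a₁ a₂ => F a₁ a₂ (b - unitVec i) := by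
  ext a₁ a₂
  simp [diffProd₂₃_singleton, diffMul_apply]

lemma diffProd₁₃_singleton_eq_add (F : (Fin n → ℤ) → (Fin n → ℤ) → (Fin n → ℤ) → W) (i : Fin n) :
    diffProd₁₃ [i] F = diffProd₁₂ [i] F + diffProd₂₃ [i] F := by
  ext a₁ a₂ b
  simp [diffProd₂₃_singleton, diffProd₁₂_singleton, diffProd₁₃_singleton, diffMul_apply]

namespace IterClearable

lemma clearable (hF : IterClearable F) (b : Fin n → ℤ) : Clearable fun a₁ a₂ => F a₁ a₂ b := by
  obtain ⟨⟨K, hK⟩, -⟩ := hF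
  exact ⟨K, hK b⟩

lemma diffProd₁₂_singleton (hF : IterClearable F) (i : Fin n) :
    IterClearable (diffProd₁₂ [i] F) := by
  refine ⟨?_, fun c => ?_⟩
  · obtain ⟨⟨K, hK⟩, -⟩ := hF
    refine ⟨K, fun b => ?_⟩
    rw [diffProd₁₂_singleton_eq, diffProd_diffMul]
    exact (hK b).diffMul i
  · simp only [diffProd₁₂_singleton_eq, diagExp_diffMul (hF.clearable _)]
    exact hF.2 _

lemma diagExp_diffProd₂₃_singleton (hF : IterClearable F) (i : Fin n) (c : Fin n → ℤ) :
    (fun a₂ b => diagExp (fun a₁ a₂ => diffProd₂₃ [i] F a₁ a₂ b) c a₂) =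
      diffMul i fun a₂ b => diagExp (fun a₁ a₂ => F a₁ a₂ b) c a₂ := by
  ext a₂ b
  rw [diffProd₂₃_singleton_eq, diagExp_sub ((hF.clearable _).shiftMul _ _) (hF.clearable _),
    diagExp_shiftMul_right (hF.clearable _), diffMul_apply]

lemma diffProd₂₃_singleton (hF : IterClearable F) (i : Fin n) :
    IterClearable (diffProd₂₃ [i] F) := by
  refine ⟨?_, fun c => ?_⟩
  · obtain ⟨⟨K, hK⟩, -⟩ := hF
    refine ⟨K, fun b => ?_⟩
    rw [diffProd₂₃_singleton_eq, map_sub, diffProd_shiftMul]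
    exact ((hK b).shiftMul _ _).sub (hK _)
  · rw [hF.diagExp_diffProd₂₃_singleton]
    exact (hF.2 _).diffMul i

lemma diagExp_add (hF : IterClearable F) (hG : IterClearable G) (c : Fin n → ℤ) :
    (fun a₂ b => diagExp (fun a₁ a₂ => (F + G) a₁ a₂ b) c a₂) =
      (fun a₂ b => diagExp (fun a₁ a₂ => F a₁ a₂ b) c a₂) +
        fun a₂ b => diagExp (fun a₁ a₂ => G a₁ a₂ b) c a₂ := by
  ext a₂ b
  exact _root_.diagExp_add (hF.clearable b) (hG.clearable b) c a₂

lemma add (hF : IterClearable F) (hG : IterClearable G) : IterClearable (F + G) := by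
  refine ⟨?_, fun c => ?_⟩
  · obtain ⟨⟨K, hK⟩, -⟩ := hF
    obtain ⟨⟨K', hK'⟩, -⟩ := hG
    refine ⟨K ++ K', fun b => ?_⟩
    change LowerTruncated₂
      (diffProd (K ++ K') ((fun a₁ a₂ => F a₁ a₂ b) + fun a₁ a₂ => G a₁ a₂ b))
    rw [map_add, diffProd_append, diffProd_append, diffProd_comm]
    exact ((hK b).diffProd K').add ((hK' b).diffProd K)
  · rw [hF.diagExp_add hG]
    exact (hF.2 c).add (hG.2 c)

lemma diffProd₁₃_singleton (hF : IterClearable F) (i : Fin n) :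
    IterClearable (diffProd₁₃ [i] F) := by
  rw [diffProd₁₃_singleton_eq_add]
  exact (hF.diffProd₁₂_singleton i).add (hF.diffProd₂₃_singleton i)

end IterClearable

lemma iterExp_diffProd₁₂_singleton (hF : IterClearable F) (i : Fin n) (c₁ c₂ b : Fin n → ℤ) :
    iterExp (diffProd₁₂ [i] F) c₁ c₂ b = iterExp F (c₁ - unitVec i) c₂ b := by
  simp only [iterExp, diffProd₁₂_singleton_eq, diagExp_diffMul (hF.clearable _)]

lemma iterExp_diffProd₂₃_singleton (hF : IterClearable F) (i : Fin n) (c₁ c₂ b : Fin n → ℤ) :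
    iterExp (diffProd₂₃ [i] F) c₁ c₂ b = iterExp F c₁ (c₂ - unitVec i) b := by
  rw [iterExp, hF.diagExp_diffProd₂₃_singleton, diagExp_diffMul (hF.2 _)]
  rfl

/-- At x₁ = x₂ + z₁, x₂ = y + z₂ the factor x₁ - y becomes z₁ + z₂, which is not a shift;
`iterExp_eq_of_succ` is there to cancel it. -/
lemma iterExp_diffProd₁₃_singleton (hF : IterClearable F) (i : Fin n) (c₁ c₂ b : Fin n → ℤ) :
    iterExp (diffProd₁₃ [i] F) c₁ c₂ b =
      iterExp F (c₁ - unitVec i) c₂ b + iterExp F c₁ (c₂ - unitVec i) b := by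
  have h₁ := hF.diffProd₁₂_singleton i
  have h₂ := hF.diffProd₂₃_singleton i
  rw [diffProd₁₃_singleton_eq_add, ← iterExp_diffProd₁₂_singleton hF,
    ← iterExp_diffProd₂₃_singleton hF, iterExp, h₁.diagExp_add h₂,
    _root_.diagExp_add (h₁.2 _) (h₂.2 _)]
  rfl

/-- A list `K` that serves all `b` bounds the pole in z₁ uniformly, so the whole inner series
vanishes. -/
lemma iterExp_of_lt {K : List (Fin n)}
    (hK : ∀ b, LowerTruncated₂ (diffProd K fun a₁ a₂ => F a₁ a₂ b)) {c₁ : Fin n → ℤ}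
    (c₂ b : Fin n → ℤ) {i : Fin n} (hc : c₁ i + listDeg K i < 0) : iterExp F c₁ c₂ b = 0 := by
  have : (fun a₂ b => diagExp (fun a₁ a₂ => F a₁ a₂ b) c₁ a₂) = 0 := by
    ext a₂ b
    exact diagExp_of_lt (hK b) a₂ hc
  rw [iterExp, this, diagExp_zero]

end

/-! ### The case without poles -/

/-- The exponents of the set of variables selected by `p` are bounded below. -/
def TruncatedAlong (p : (Fin n → ℤ) → (Fin n → ℤ) → (Fin n → ℤ) → (Fin n → ℤ))
    (F : (Fin n → ℤ) → (Fin n → ℤ) → (Fin n → ℤ) → W) : Prop :=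
  ∃ N : ℤ, ∀ a₁ a₂ b : Fin n → ℤ, (∃ i, p a₁ a₂ b i < N) → F a₁ a₂ b = 0

/-- The exponents of all the variables are bounded below. -/
def LowerTruncated₃ (F : (Fin n → ℤ) → (Fin n → ℤ) → (Fin n → ℤ) → W) : Prop :=
  ∃ N : ℤ, ∀ a₁ a₂ b : Fin n → ℤ, (∃ i, a₁ i < N ∨ a₂ i < N ∨ b i < N) → F a₁ a₂ b = 0

section

variable {F : (Fin n → ℤ) → (Fin n → ℤ) → (Fin n → ℤ) → W}

lemma LowerTruncated₃.of_truncatedAlong (h₁ : TruncatedAlong (fun a₁ _ _ => a₁) F)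
    (h₂ : TruncatedAlong (fun _ a₂ _ => a₂) F) (h₃ : TruncatedAlong (fun _ _ b => b) F) :
    LowerTruncated₃ F := by
  obtain ⟨N₁, h₁⟩ := h₁
  obtain ⟨N₂, h₂⟩ := h₂
  obtain ⟨N₃, h₃⟩ := h₃
  refine ⟨min N₁ (min N₂ N₃), ?_⟩
  rintro a₁ a₂ b ⟨i, h | h | h⟩
  · exact h₁ a₁ a₂ b ⟨i, by simp only; lia⟩
  · exact h₂ a₁ a₂ b ⟨i, by simp only; lia⟩
  · exact h₃ a₁ a₂ b ⟨i, by simp only; lia⟩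

lemma TruncatedAlong.shiftMul₃_sub {p : (Fin n → ℤ) → (Fin n → ℤ) → (Fin n → ℤ) → (Fin n → ℤ)}
    (hp : ∀ a₁ a₂ b g₁ g₂ h, p (a₁ - g₁) (a₂ - g₂) (b - h) = p a₁ a₂ b - p g₁ g₂ h)
    (hF : TruncatedAlong p F) (g₁ g₂ g₃ h₁ h₂ h₃ : Fin n → ℤ) :
    TruncatedAlong p ((shiftMul₃ g₁ g₂ g₃ - shiftMul₃ h₁ h₂ h₃ :
      Module.End ℂ ((Fin n → ℤ) → (Fin n → ℤ) → (Fin n → ℤ) → W)) F) := by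
  obtain ⟨N, hN⟩ := hF
  obtain ⟨M, hM⟩ := exists_forall_le (p g₁ g₂ g₃)
  obtain ⟨M', hM'⟩ := exists_forall_le (p h₁ h₂ h₃)
  refine ⟨N + min M M', fun a₁ a₂ b ⟨i, hi⟩ => ?_⟩
  have := hM i
  have := hM' i
  change F _ _ _ - F _ _ _ = 0
  rw [hN, hN, sub_zero]
  · exact ⟨i, by rw [hp, Pi.sub_apply]; lia⟩
  · exact ⟨i, by rw [hp, Pi.sub_apply]; lia⟩

lemma TruncatedAlong.list_prod {p : (Fin n → ℤ) → (Fin n → ℤ) → (Fin n → ℤ) → (Fin n → ℤ)}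
    {x : Fin n → Module.End ℂ ((Fin n → ℤ) → (Fin n → ℤ) → (Fin n → ℤ) → W)}
    (hx : ∀ i F, TruncatedAlong p F → TruncatedAlong p (x i F)) (hF : TruncatedAlong p F)
    (L : List (Fin n)) : TruncatedAlong p ((L.map x).prod F) := by
  induction L with
  | nil => exact hF
  | cons i L ih =>
    rw [List.map_cons, List.prod_cons]
    exact hx i _ ih

/-- The three exponents of `F` have sum b + c₁ + c₂ and are at least `N`, so each is at most that
sum minus 2N. The resulting box is symmetric in the first two variables. -/
lemma LowerTruncated₃.nestedExp_eq_sum {N : ℤ}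
    (hN : ∀ a₁ a₂ b : Fin n → ℤ, (∃ i, a₁ i < N ∨ a₂ i < N ∨ b i < N) → F a₁ a₂ b = 0)
    {c₁ c₂ b : Fin n → ℤ} :
    nestedExp F c₁ c₂ b = ∑ a₁ ∈ Finset.Icc (fun _ => N) (b + c₁ + c₂ - fun _ => 2 * N),
      ∑ a₂ ∈ Finset.Icc (fun _ => N) (b + c₁ + c₂ - fun _ => 2 * N),
        (multiBinom a₁ c₁ * multiBinom a₂ c₂) • F a₁ a₂ (b + c₁ + c₂ - a₁ - a₂) := by
  have hF₁ (a₁ : Fin n → ℤ) : ∀ a₂ b : Fin n → ℤ, (∃ i, a₂ i < N ∨ b i < N) → F a₁ a₂ b = 0 :=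
    fun a₂ b ⟨i, hi⟩ => hN a₁ a₂ b ⟨i, .inr hi⟩
  have hF₂ (a₁ b : Fin n → ℤ) : diagExp (F a₁) c₂ b = taylor (F a₁) c₂ b :=
    diagExp_eq_taylor ⟨N, hF₁ a₁⟩ c₂ b
  obtain ⟨M, hM⟩ := exists_forall_ge c₂
  have hF₃ : LowerTruncated₂ fun a₁ b => taylor (F a₁) c₂ b := by
    refine ⟨min N (N + N - M), fun a₁ b ⟨i, hi⟩ => ?_⟩
    rcases hi with hi | hi
    · have : F a₁ = 0 := by
        ext a₂ b
        exact hN a₁ a₂ b ⟨i, .inl (by lia)⟩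
      simp [this, taylor]
    · have := hM i
      exact taylor_eq_zero (hF₁ a₁) (i := i) (by lia)
  simp only [nestedExp, hF₂]
  rw [diagExp_eq_taylor hF₃]
  have hout {a₁ a₂ : Fin n → ℤ} (h : a₁ ∉ Finset.Icc (fun _ => N) (b + c₁ + c₂ - fun _ => 2 * N) ∨
      a₂ ∉ Finset.Icc (fun _ => N) (b + c₁ + c₂ - fun _ => 2 * N)) :
      F a₁ a₂ (b + c₁ + c₂ - a₁ - a₂) = 0 := by
    refine hN _ _ _ ?_
    by_contra! h'
    rcases h with h | h <;> refine h (Finset.mem_Icc.2 ⟨fun i => ?_, fun i => ?_⟩) <;>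
      have := h' i <;> simp only [Pi.sub_apply, Pi.add_apply] at this ⊢ <;> lia
  have hb (a₁ a₂ : Fin n → ℤ) : b + c₁ - a₁ + c₂ - a₂ = b + c₁ + c₂ - a₁ - a₂ := by abel
  rw [taylor_eq_sum (s := Finset.Icc (fun _ => N) (b + c₁ + c₂ - fun _ => 2 * N))]
  · refine Finset.sum_congr rfl fun a₁ _ => ?_
    rw [taylor_eq_sum (s := Finset.Icc (fun _ => N) (b + c₁ + c₂ - fun _ => 2 * N)),
      Finset.smul_sum]
    · refine Finset.sum_congr rfl fun a₂ _ => ?_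
      rw [smul_smul, hb]
    · intro a₂ h
      rw [hb, hout (.inr h)]
  · intro a₁ h
    refine finsum_eq_zero_of_forall_eq_zero fun a₂ => ?_
    rw [hb, hout (.inl h), smul_zero]

lemma LowerTruncated₃.nestedExp_swap (hF : LowerTruncated₃ F) (c₁ c₂ b : Fin n → ℤ) :
    nestedExp F c₁ c₂ b = nestedExp (fun a₁ a₂ => F a₂ a₁) c₂ c₁ b := by
  obtain ⟨N, hN⟩ := hF
  rw [nestedExp_eq_sum hN, nestedExp_eq_sum (N := N), Finset.sum_comm,
    show b + c₂ + c₁ = b + c₁ + c₂ by abel]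
  · refine Finset.sum_congr rfl fun a₁ _ => Finset.sum_congr rfl fun a₂ _ => ?_
    rw [mul_comm, sub_right_comm]
  · rintro a₁ a₂ b ⟨i, hi⟩
    exact hN _ _ _ ⟨i, by tauto⟩

/-- Two computations of the coefficient of z₁^(c₁) z₂^(c₂) in (y + z₂ + z₁)^(a₁) (y + z₂)^(a₂), up
to the power of y. Extracting the binomial of a₁ and c₁ leaves Vandermonde's identity in r = e - c₁.
-/
lemma sum_multiBinom_mul (a₁ a₂ c₁ c₂ : Fin n → ℤ) :
    ∑ e ∈ Finset.Icc 0 (c₂ + c₁),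
      multiBinom e c₁ * (multiBinom a₁ e * multiBinom a₂ (c₂ + c₁ - e)) =
      multiBinom a₁ c₁ * multiBinom (a₂ + (a₁ - c₁)) c₂ := by
  by_cases hc : 0 ≤ c₁
  swap
  · obtain ⟨i, hi⟩ : ∃ i, c₁ i < 0 := by simpa [Pi.le_def] using hc
    simp [multiBinom_of_neg _ hi]
  rw [multiBinom_add, Finset.mul_sum]
  symm
  refine Finset.sum_of_injOn (fun r => r + c₁) (add_left_injective c₁).injOn ?_ ?_ ?_
  · intro r hr
    rw [Finset.coe_Icc, Set.mem_Icc] at hr ⊢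
    exact ⟨add_nonneg hr.1 hc, add_le_add hr.2 le_rfl⟩
  · intro e he hr
    rw [mul_left_comm, ← mul_assoc, multiBinom_mul_multiBinom]
    obtain ⟨i, hi⟩ : ∃ i, (e - c₁) i < 0 := by
      by_contra! h
      refine hr ⟨e - c₁, ?_, by simp⟩
      rw [Finset.mem_Icc] at he
      rw [Finset.coe_Icc]
      exact ⟨h, by simpa using he.2⟩
    rw [multiBinom_of_neg _ hi, mul_zero, zero_mul]
  · intro r hr
    rw [← mul_assoc, ← mul_assoc, mul_comm (multiBinom (r + c₁) c₁), multiBinom_mul_multiBinom,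
      add_sub_cancel_right, add_sub_add_right_eq_sub]

lemma LowerTruncated₃.lowerTruncated₂_nestedExp (hF : LowerTruncated₃ F) (b : Fin n → ℤ) :
    LowerTruncated₂ fun c₁ c₂ => nestedExp F c₁ c₂ b := by
  obtain ⟨N, hN⟩ := hF
  refine ⟨0, fun c₁ c₂ ⟨i, hi⟩ => ?_⟩
  change nestedExp F c₁ c₂ b = 0
  rw [nestedExp_eq_sum hN]
  refine Finset.sum_eq_zero fun a₁ _ => Finset.sum_eq_zero fun a₂ _ => ?_
  rcases hi with hi | hi <;> simp [multiBinom_of_neg _ hi]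

/-- Substituting x₂ + z₁ and then x₂ = y + z₂ puts x₁ at y + (z₂ + z₁): the nested expansion with
its first variable expanded around the second. -/
lemma LowerTruncated₃.iterExp_eq (hF : LowerTruncated₃ F) (c₁ c₂ b : Fin n → ℤ) :
    iterExp F c₁ c₂ b = taylor (fun c₁ c₂ => nestedExp F c₁ c₂ b) c₁ c₂ := by
  obtain ⟨N, hN⟩ := hF
  have hF₁ (b : Fin n → ℤ) : ∀ a₁ a₂ : Fin n → ℤ, (∃ i, a₁ i < N ∨ a₂ i < N) → F a₁ a₂ b = 0 :=
    fun a₁ a₂ ⟨i, hi⟩ => hN a₁ a₂ b ⟨i, by tauto⟩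
  have hF₁' (a₁ : Fin n → ℤ) : LowerTruncated₂ (F a₁) :=
    ⟨N, fun a₂ b ⟨i, hi⟩ => hN a₁ a₂ b ⟨i, .inr hi⟩⟩
  have hF₂ (a₂ b : Fin n → ℤ) : diagExp (fun a₁ a₂ => F a₁ a₂ b) c₁ a₂ =
      taylor (fun a₁ a₂ => F a₁ a₂ b) c₁ a₂ := diagExp_eq_taylor ⟨N, hF₁ b⟩ c₁ a₂
  obtain ⟨M, hM⟩ := exists_forall_ge c₁
  have hF₃ : LowerTruncated₂ fun a₂ b => taylor (fun a₁ a₂ => F a₁ a₂ b) c₁ a₂ := by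
    refine ⟨min N (N + N - M), fun a₂ b ⟨i, hi⟩ => ?_⟩
    rcases hi with hi | hi
    · have := hM i
      exact taylor_eq_zero (hF₁ b) (i := i) (by lia)
    · refine finsum_eq_zero_of_forall_eq_zero fun a₁ => ?_
      have : F a₁ (a₂ + c₁ - a₁) b = 0 := hN _ _ _ ⟨i, .inr (.inr (by lia))⟩
      simp [this]
  simp only [iterExp, hF₂]
  rw [diagExp_eq_taylor hF₃]
  have hout {a₁ a₂ b' : Fin n → ℤ} (hb : a₁ + a₂ + b' = b + c₂ + c₁)
      (h : a₁ ∉ Finset.Icc (fun _ => N) (b + c₂ + c₁ - fun _ => 2 * N) ∨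
        a₂ ∉ Finset.Icc (fun _ => N) (b + c₂ + c₁ - fun _ => 2 * N)) : F a₁ a₂ b' = 0 := by
    refine hN _ _ _ ?_
    by_contra! h'
    rcases h with h | h <;> refine h (Finset.mem_Icc.2 ⟨fun i => ?_, fun i => ?_⟩) <;>
      have := h' i <;> have := congrFun hb i <;>
      simp only [Pi.sub_apply, Pi.add_apply] at this ⊢ <;> lia
  have hleft : taylor (fun a₂ b => taylor (fun a₁ a₂ => F a₁ a₂ b) c₁ a₂) c₂ b =
      ∑ a₁ ∈ Finset.Icc (fun _ => N) (b + c₂ + c₁ - fun _ => 2 * N),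
        ∑ a₂ ∈ Finset.Icc (fun _ => N) (b + c₂ + c₁ - fun _ => 2 * N),
          (multiBinom a₁ c₁ * multiBinom (a₂ + (a₁ - c₁)) c₂) •
            F a₁ a₂ (b + c₂ + c₁ - a₁ - a₂) := by
    have hinner (a₂ : Fin n → ℤ) : taylor (fun a₁ a => F a₁ a (b + c₂ - a₂)) c₁ a₂ =
        ∑ a₁ ∈ Finset.Icc (fun _ => N) (b + c₂ + c₁ - fun _ => 2 * N),
          multiBinom a₁ c₁ • F a₁ (a₂ + c₁ - a₁) (b + c₂ - a₂) :=
      taylor_eq_sum fun a₁ h => hout (by abel) (.inl h)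
    rw [taylor]
    simp only [hinner, Finset.smul_sum, smul_smul]
    rw [finsum_sum_comm]
    · refine Finset.sum_congr rfl fun a₁ _ => ?_
      -- The shift makes `a₂` the exponent of x₂ in `F` itself, before x₁^(a₁) contributes the power
      -- a₁ - c₁.
      rw [← finsum_comp_equiv (Equiv.addRight (a₁ - c₁)), finsum_eq_sum_of_support_subset
        (s := Finset.Icc (fun _ => N) (b + c₂ + c₁ - fun _ => 2 * N))]
      · refine Finset.sum_congr rfl fun a₂ _ => ?_
        rw [Equiv.coe_addRight, mul_comm, show a₂ + (a₁ - c₁) + c₁ - a₁ = a₂ by abel,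
          show b + c₂ - (a₂ + (a₁ - c₁)) = b + c₂ + c₁ - a₁ - a₂ by abel]
      · intro a₂ ha
        by_contra h
        refine ha ?_
        have : F a₁ (a₂ + (a₁ - c₁) + c₁ - a₁) (b + c₂ - (a₂ + (a₁ - c₁))) = 0 := by
          refine hout (by abel) (.inr ?_)
          rwa [show a₂ + (a₁ - c₁) + c₁ - a₁ = a₂ by abel]
        simp [this]
    · intro a₁ _
      have := (hF₁' a₁).finite_support (fun a₂ => multiBinom a₂ c₂ * multiBinom a₁ c₁)
        (a₁ - c₁) (b + c₂)
      simp only [sub_sub_eq_add_sub] at this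
      exact this
  rw [hleft, taylor_eq_sum (s := Finset.Icc 0 (c₂ + c₁))]
  · have hright (e : Fin n → ℤ) : nestedExp F e (c₂ + c₁ - e) b =
        ∑ a₁ ∈ Finset.Icc (fun _ => N) (b + c₂ + c₁ - fun _ => 2 * N),
          ∑ a₂ ∈ Finset.Icc (fun _ => N) (b + c₂ + c₁ - fun _ => 2 * N),
            (multiBinom a₁ e * multiBinom a₂ (c₂ + c₁ - e)) •
              F a₁ a₂ (b + c₂ + c₁ - a₁ - a₂) := by
      rw [nestedExp_eq_sum hN, show b + e + (c₂ + c₁ - e) = b + c₂ + c₁ by abel]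
    simp only [hright, Finset.smul_sum, smul_smul]
    symm
    rw [Finset.sum_comm]
    refine Finset.sum_congr rfl fun a₁ _ => ?_
    rw [Finset.sum_comm]
    refine Finset.sum_congr rfl fun a₂ _ => ?_
    rw [← Finset.sum_smul, sum_multiBinom_mul]
  · intro e he
    rw [nestedExp_eq_sum hN]
    obtain ⟨i, hi⟩ | ⟨i, hi⟩ : (∃ i, e i < 0) ∨ ∃ i, (c₂ + c₁ - e) i < 0 := by
      by_contra! h
      exact he (Finset.mem_Icc.2 ⟨h.1, fun i => by simpa using h.2 i⟩)
    all_goals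
      refine Finset.sum_eq_zero fun a₁ _ => Finset.sum_eq_zero fun a₂ _ => ?_
      simp [multiBinom_of_neg _ hi]

end
end

section

variable {n : ℕ} {W : Type*} [AddCommGroup W] [Module ℂ W]

/-! ### Commutativity and associativity of diagonal expansions -/

/-- To prove a property of `F` when a product of `F` by differences of variables has no poles, one
can put back the factors one by one. -/
lemma induction_of_lowerTruncated₃ {P : ((Fin n → ℤ) → (Fin n → ℤ) → (Fin n → ℤ) → W) → Prop}
    (h₀ : ∀ F, LowerTruncated₃ F → P F) (h₁₃ : ∀ i F, P (diffProd₁₃ [i] F) → P F)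
    (h₂₃ : ∀ i F, P (diffProd₂₃ [i] F) → P F) {L₁ L₂ : List (Fin n)}
    {F : (Fin n → ℤ) → (Fin n → ℤ) → (Fin n → ℤ) → W}
    (hF : LowerTruncated₃ (diffProd₁₃ L₁ (diffProd₂₃ L₂ F))) : P F := by
  induction L₁ using List.reverseRecOn generalizing F with
  | nil =>
    induction L₂ using List.reverseRecOn generalizing F with
    | nil => exact h₀ F hF
    | append_singleton L₂ i ih =>
      rw [diffProd₂₃_append] at hF
      exact h₂₃ i F (ih hF)
  | append_singleton L₁ i ih =>
    -- The last factor is commuted inwards until it acts directly on `F`.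
    rw [diffProd₁₃_append, diffProd₁₃_diffProd₂₃ F [i]] at hF
    exact h₁₃ i F (ih hF)

section

variable {F : (Fin n → ℤ) → (Fin n → ℤ) → (Fin n → ℤ) → W}

lemma swap_diffProd₁₃_singleton (F : (Fin n → ℤ) → (Fin n → ℤ) → (Fin n → ℤ) → W) (i : Fin n) :
    (fun a₁ a₂ => diffProd₁₃ [i] F a₂ a₁) = diffProd₂₃ [i] fun a₁ a₂ => F a₂ a₁ := by
  ext a₁ a₂ b
  simp [diffProd₂₃_singleton, diffProd₁₃_singleton, diffMul_apply]

lemma swap_diffProd₂₃_singleton (F : (Fin n → ℤ) → (Fin n → ℤ) → (Fin n → ℤ) → W) (i : Fin n) :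
    (fun a₁ a₂ => diffProd₂₃ [i] F a₂ a₁) = diffProd₁₃ [i] fun a₁ a₂ => F a₂ a₁ := by
  ext a₁ a₂ b
  simp [diffProd₂₃_singleton, diffProd₁₃_singleton, diffMul_apply]

lemma swap_diffProd₁₂ (F : (Fin n → ℤ) → (Fin n → ℤ) → (Fin n → ℤ) → W) (L : List (Fin n)) :
    (fun a₁ a₂ => diffProd₁₂ L F a₂ a₁) =
      (-1 : ℂ) ^ L.length • diffProd₁₂ L fun a₁ a₂ => F a₂ a₁ := by
  ext a₁ a₂ b
  simp only [Pi.smul_apply]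
  rw [diffProd₁₂_apply, diffProd₁₂_apply, ← diffProd_swap]

/-- There are no poles along x₁ = x₂, and the factors x₁ - y and x₂ - y shift the two sides in the
same way, so the symmetry of the case without poles survives. -/
lemma nestedExp_swap {L₁ L₂ : List (Fin n)}
    (hL : LowerTruncated₃ (diffProd₁₃ L₁ (diffProd₂₃ L₂ F)))
    (hF : NestedClearable F) (hF' : NestedClearable fun a₁ a₂ => F a₂ a₁) (c₁ c₂ b : Fin n → ℤ) :
    nestedExp F c₁ c₂ b = nestedExp (fun a₁ a₂ => F a₂ a₁) c₂ c₁ b := by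
  refine induction_of_lowerTruncated₃ (P := fun F => NestedClearable F →
    NestedClearable (fun a₁ a₂ => F a₂ a₁) → ∀ c₁ c₂ b : Fin n → ℤ,
      nestedExp F c₁ c₂ b = nestedExp (fun a₁ a₂ => F a₂ a₁) c₂ c₁ b) ?_ ?_ ?_ hL hF hF' c₁ c₂ b
  · exact fun F h _ _ c₁ c₂ b => h.nestedExp_swap c₁ c₂ b
  · intro i F ih hF hF' c₁ c₂ b
    have := ih (hF.diffProd₁₃_singleton i)
      (by rw [swap_diffProd₁₃_singleton]; exact hF'.diffProd₂₃_singleton i) (c₁ + unitVec i) c₂ b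
    rwa [swap_diffProd₁₃_singleton, nestedExp_diffProd₁₃_singleton hF,
      nestedExp_diffProd₂₃_singleton hF', add_sub_cancel_right] at this
  · intro i F ih hF hF' c₁ c₂ b
    have := ih (hF.diffProd₂₃_singleton i)
      (by rw [swap_diffProd₂₃_singleton]; exact hF'.diffProd₁₃_singleton i) c₁ (c₂ + unitVec i) b
    rwa [swap_diffProd₂₃_singleton, nestedExp_diffProd₂₃_singleton hF,
      nestedExp_diffProd₁₃_singleton hF', add_sub_cancel_right] at this

lemma nestedExp_diffProd₁₃_singleton_eq (hF : NestedClearable F) (i : Fin n) (b : Fin n → ℤ) :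
    (fun c₁ c₂ => nestedExp (diffProd₁₃ [i] F) c₁ c₂ b) =
      shiftMul (unitVec i) 0 fun c₁ c₂ => nestedExp F c₁ c₂ b := by
  ext c₁ c₂
  simp [nestedExp_diffProd₁₃_singleton hF]

lemma nestedExp_diffProd₂₃_singleton_eq (hF : NestedClearable F) (i : Fin n) (b : Fin n → ℤ) :
    (fun c₁ c₂ => nestedExp (diffProd₂₃ [i] F) c₁ c₂ b) =
      shiftMul 0 (unitVec i) fun c₁ c₂ => nestedExp F c₁ c₂ b := by
  ext c₁ c₂
  simp [nestedExp_diffProd₂₃_singleton hF]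

lemma shiftMul_shiftMul_neg (g h : Fin n → ℤ) (f : (Fin n → ℤ) → (Fin n → ℤ) → W) :
    shiftMul (-g) (-h) (shiftMul g h f) = f := by
  ext a b
  simp

lemma Clearable.of_shiftMul {g h : Fin n → ℤ} {f : (Fin n → ℤ) → (Fin n → ℤ) → W}
    (hf : Clearable (_root_.shiftMul g h f)) : Clearable f := by
  have := hf.shiftMul (-g) (-h)
  rwa [shiftMul_shiftMul_neg] at this

/-- Multiplication by the `i`-th z₁ + z₂ is injective on series with a bounded pole in z₁:
coefficients are compared by induction on the exponent of z₁, upwards from the pole order. -/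
lemma iterExp_eq_of_succ {g : (Fin n → ℤ) → (Fin n → ℤ) → W} {b : Fin n → ℤ} (i : Fin n)
    (hF : IterClearable F) (hg : Clearable g)
    (h : ∀ c₁ c₂, iterExp F (c₁ - unitVec i) c₂ b + iterExp F c₁ (c₂ - unitVec i) b =
      diagExp g (c₁ - unitVec i) c₂ + diagExp g c₁ (c₂ - unitVec i)) (c₁ c₂ : Fin n → ℤ) :
    iterExp F c₁ c₂ b = diagExp g c₁ c₂ := by
  obtain ⟨K, hK⟩ := hF.1
  obtain ⟨L, hL⟩ := hg
  obtain ⟨N, hN⟩ : ∃ N : ℕ, c₁ i + max (listDeg K i) (listDeg L i) < N :=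
    ⟨(c₁ i + max (listDeg K i) (listDeg L i) + 1).toNat, by lia⟩
  induction N generalizing c₁ c₂ with
  | zero => rw [iterExp_of_lt hK (i := i), diagExp_of_lt hL (i := i)] <;> lia
  | succ N ih =>
    have h₁ := h c₁ (c₂ + unitVec i)
    have hlt : (c₁ - unitVec i) i + max (listDeg K i) (listDeg L i) < N := by
      simp only [Pi.sub_apply, Pi.single_eq_same]
      push_cast at hN
      lia
    rw [ih _ _ hlt, add_sub_cancel_right] at h₁
    exact add_left_cancel h₁

lemma iterExp_eq_of_lowerTruncated₃ {L₁ L₂ : List (Fin n)}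
    (hL : LowerTruncated₃ (diffProd₁₃ L₁ (diffProd₂₃ L₂ F)))
    (hF : NestedClearable F) (hF' : IterClearable F) (b : Fin n → ℤ) :
    Clearable (fun c₁ c₂ => nestedExp F c₁ c₂ b) ∧ ∀ c₁ c₂,
      iterExp F c₁ c₂ b = diagExp (fun c₁ c₂ => nestedExp F c₁ c₂ b) c₁ c₂ := by
  refine induction_of_lowerTruncated₃ (P := fun F => NestedClearable F → IterClearable F →
    Clearable (fun c₁ c₂ => nestedExp F c₁ c₂ b) ∧ ∀ c₁ c₂,
      iterExp F c₁ c₂ b = diagExp (fun c₁ c₂ => nestedExp F c₁ c₂ b) c₁ c₂) ?_ ?_ ?_ hL hF hF'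
  · intro F h _ _
    refine ⟨⟨[], h.lowerTruncated₂_nestedExp b⟩, fun c₁ c₂ => ?_⟩
    rw [h.iterExp_eq, diagExp_eq_taylor (h.lowerTruncated₂_nestedExp b)]
  · intro i F ih hF hF'
    obtain ⟨h₁, h₂⟩ := ih (hF.diffProd₁₃_singleton i) (hF'.diffProd₁₃_singleton i)
    rw [nestedExp_diffProd₁₃_singleton_eq hF] at h₁ h₂
    have h₃ := Clearable.of_shiftMul h₁
    refine ⟨h₃, iterExp_eq_of_succ i hF' h₃ fun c₁ c₂ => ?_⟩
    rw [← iterExp_diffProd₁₃_singleton hF', h₂, diagExp_shiftMul_unitVec h₃]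
  · intro i F ih hF hF'
    obtain ⟨h₁, h₂⟩ := ih (hF.diffProd₂₃_singleton i) (hF'.diffProd₂₃_singleton i)
    rw [nestedExp_diffProd₂₃_singleton_eq hF] at h₁ h₂
    have h₃ := Clearable.of_shiftMul h₁
    refine ⟨h₃, fun c₁ c₂ => ?_⟩
    have := h₂ c₁ (c₂ + unitVec i)
    rwa [iterExp_diffProd₂₃_singleton hF', diagExp_shiftMul_right h₃, add_sub_cancel_right] at this

/-- The remaining poles, along x₁ = x₂: the factor becomes z₁ in the iterated expansion, and a
difference of the two variables of the nested one, which `diagExp` also turns into z₁. -/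
lemma iterExp_eq_diagExp_nestedExp {L L₁ L₂ : List (Fin n)}
    (hL : LowerTruncated₃ (diffProd₁₃ L₁ (diffProd₂₃ L₂ (diffProd₁₂ L F))))
    (hF : NestedClearable F) (hF' : IterClearable F) (b : Fin n → ℤ) :
    Clearable (fun c₁ c₂ => nestedExp F c₁ c₂ b) ∧ ∀ c₁ c₂,
      iterExp F c₁ c₂ b = diagExp (fun c₁ c₂ => nestedExp F c₁ c₂ b) c₁ c₂ := by
  induction L using List.reverseRecOn generalizing F with
  | nil => exact iterExp_eq_of_lowerTruncated₃ hL hF hF' b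
  | append_singleton L i ih =>
    rw [diffProd₁₂_append] at hL
    obtain ⟨h₁, h₂⟩ := ih hL (hF.diffProd₁₂_singleton i) (hF'.diffProd₁₂_singleton i)
    have h : (fun c₁ c₂ => nestedExp (diffProd₁₂ [i] F) c₁ c₂ b) =
        diffMul i fun c₁ c₂ => nestedExp F c₁ c₂ b := by
      ext c₁ c₂
      rw [nestedExp_diffProd₁₂_singleton hF, diffMul_apply]
    rw [h] at h₁ h₂
    have h₃ : Clearable fun c₁ c₂ => nestedExp F c₁ c₂ b := by
      refine Clearable.of_diffProd (L := [i]) ?_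
      rwa [diffProd_cons, diffProd_nil]
    refine ⟨h₃, fun c₁ c₂ => ?_⟩
    have := h₂ (c₁ + unitVec i) c₂
    rwa [iterExp_diffProd₁₂_singleton hF', diagExp_diffMul h₃, add_sub_cancel_right] at this

/-- If `F` and `G` agree up to the exchange of the first two variables and up to poles, then so do
their nested expansions. -/
lemma diffProd_nestedExp_swap {G : (Fin n → ℤ) → (Fin n → ℤ) → (Fin n → ℤ) → W}
    {L L₁ L₂ : List (Fin n)}
    (hL : LowerTruncated₃ (diffProd₁₃ L₁ (diffProd₂₃ L₂ (diffProd₁₂ L F))))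
    (hFG : diffProd₁₂ L F = diffProd₁₂ L fun a₁ a₂ => G a₂ a₁)
    (hF : NestedClearable F) (hG : NestedClearable G) (b : Fin n → ℤ) :
    diffProd L (fun c₁ c₂ => nestedExp F c₁ c₂ b) =
      diffProd L fun c₁ c₂ => nestedExp G c₂ c₁ b := by
  -- Exchanging x₁ and x₂ gives a sign for each factor; exchanging z₁ and z₂ gives the same sign,
  -- and they cancel.
  have hswap : (fun a₁ a₂ => diffProd₁₂ L F a₂ a₁) = (-1 : ℂ) ^ L.length • diffProd₁₂ L G := by
    rw [hFG, swap_diffProd₁₂]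
  ext c₁ c₂
  rw [← nestedExp_diffProd₁₂ hF, nestedExp_swap hL (hF.diffProd₁₂ L), hswap,
    nestedExp_smul (hG.diffProd₁₂ L), nestedExp_diffProd₁₂ hG, diffProd_swap L fun c₁ c₂ =>
      nestedExp G c₁ c₂ b]
  rw [hswap]
  exact (hG.diffProd₁₂ L).smul _

end

/-! ### The vertex algebra of a closed local subspace -/

lemma nthProd_neg_apply {ψ φ : OpSeries n W} (h : MutuallyLocal ψ φ) (hψ : ψ ∈ VO n W)
    (hφ : φ ∈ VO n W) (c b : Fin n → ℤ) (w : W) :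
    nthProd (-c - 1) ψ φ b w = diagExp (fun a b => ψ a (φ b w)) c b := by
  rw [nthProd_apply h hψ hφ]
  congr 1
  abel

namespace IsClosedLocal

variable {V : Submodule ℂ (OpSeries n W)}

lemma mem_VO (hV : IsClosedLocal V) {u : OpSeries n W} (hu : u ∈ V) : u ∈ VO n W := hV.1.1 hu

lemma mutuallyLocal (hV : IsClosedLocal V) {u v : OpSeries n W} (hu : u ∈ V) (hv : v ∈ V) :
    MutuallyLocal u v :=
  hV.1.2 u hu v hv

lemma clearable (hV : IsClosedLocal V) {u v : OpSeries n W} (hu : u ∈ V) (hv : v ∈ V) (w : W) :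
    Clearable fun a b => u a (v b w) :=
  (hV.mutuallyLocal hu hv).clearable (hV.mem_VO hu) (hV.mem_VO hv) w

lemma nthProd_apply (hV : IsClosedLocal V) {u v : OpSeries n W} (hu : u ∈ V) (hv : v ∈ V)
    (c b : Fin n → ℤ) (w : W) :
    nthProd (-c - 1) u v b w = diagExp (fun a b => u a (v b w)) c b :=
  nthProd_neg_apply (hV.mutuallyLocal hu hv) (hV.mem_VO hu) (hV.mem_VO hv) c b w

/-- The vertex operators `Y(u, z) v = ∑_m (u_m v) z ^ (-m - 1)`. -/
noncomputable def vertexOp (hV : IsClosedLocal V) : V →ₗ[ℂ] OpSeries n V :=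
  LinearMap.pi fun c => LinearMap.mk₂ ℂ
    (fun u v : V => (⟨nthProd (-c - 1) u v, hV.2 u u.2 v v.2 _⟩ : V))
    (fun u u' v => by
      ext b w
      simp only [Submodule.coe_add, Pi.add_apply, LinearMap.add_apply]
      rw [← Submodule.coe_add, hV.nthProd_apply (u + u').2 v.2, hV.nthProd_apply u.2 v.2,
        hV.nthProd_apply u'.2 v.2, ← diagExp_add (hV.clearable u.2 v.2 w) (hV.clearable u'.2 v.2 w)]
      rfl)
    (fun r u v => by
      ext b w
      simp only [Submodule.coe_smul, Pi.smul_apply, LinearMap.smul_apply]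
      rw [← Submodule.coe_smul, hV.nthProd_apply (r • u).2 v.2, hV.nthProd_apply u.2 v.2,
        ← diagExp_smul r (hV.clearable u.2 v.2 w)]
      rfl)
    (fun u v v' => by
      ext b w
      simp only [Submodule.coe_add, Pi.add_apply, LinearMap.add_apply]
      rw [← Submodule.coe_add, hV.nthProd_apply u.2 (v + v').2, hV.nthProd_apply u.2 v.2,
        hV.nthProd_apply u.2 v'.2, ← diagExp_add (hV.clearable u.2 v.2 w) (hV.clearable u.2 v'.2 w)]
      congr 1
      ext a b
      simp)
    (fun r u v => by
      ext b w
      simp only [Submodule.coe_smul, Pi.smul_apply, LinearMap.smul_apply]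
      rw [← Submodule.coe_smul, hV.nthProd_apply u.2 (r • v).2, hV.nthProd_apply u.2 v.2,
        ← diagExp_smul r (hV.clearable u.2 v.2 w)]
      congr 1
      ext a b
      simp)

lemma coe_vertexOp (hV : IsClosedLocal V) (u v : V) (c : Fin n → ℤ) :
    (hV.vertexOp u c v : OpSeries n W) = nthProd (-c - 1) u v := rfl

lemma vertexOp_apply (hV : IsClosedLocal V) (u v : V) (c b : Fin n → ℤ) (w : W) :
    (hV.vertexOp u c v : OpSeries n W) b w = diagExp (fun a b => (u : OpSeries n W) a (v.1 b w)) c b :=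
  hV.nthProd_apply u.2 v.2 c b w

lemma vertexOp_mem_VO (hV : IsClosedLocal V) (u : V) : hV.vertexOp u ∈ VO n V := by
  intro v
  obtain ⟨L, hL⟩ := (hV.mutuallyLocal u.2 v.2).exists_lowerTruncated₂ (hV.mem_VO u.2)
    (hV.mem_VO v.2)
  obtain ⟨M, hM⟩ := exists_forall_ge (listDeg L)
  refine ⟨-M, fun c ⟨i, hi⟩ => ?_⟩
  ext b w
  rw [hV.vertexOp_apply, diagExp_of_lt (hL w) b (i := i)]
  · rfl
  · have := hM i
    lia

/-! ### Products of three vertex operators -/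

lemma nestedClearable (hV : IsClosedLocal V) (u v w : V) (x : W) :
    NestedClearable fun a₁ a₂ b => u.1 a₁ (v.1 a₂ (w.1 b x)) := by
  refine ⟨fun a₁ => (hV.clearable v.2 w.2 x).map (u.1 a₁), fun c => ?_⟩
  simp only [diagExp_map _ (hV.clearable v.2 w.2 x), ← hV.vertexOp_apply]
  exact hV.clearable u.2 (hV.vertexOp v c w).2 x

lemma iterClearable (hV : IsClosedLocal V) (u v w : V) (x : W) :
    IterClearable fun a₁ a₂ b => u.1 a₁ (v.1 a₂ (w.1 b x)) := by
  obtain ⟨K, hK⟩ := (hV.mutuallyLocal u.2 v.2).exists_lowerTruncated₂ (hV.mem_VO u.2)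
    (hV.mem_VO v.2)
  refine ⟨⟨K, fun b => hK _⟩, fun c => ?_⟩
  simp only [← hV.vertexOp_apply]
  exact hV.clearable (hV.vertexOp u c v).2 w.2 x

lemma vertexOp_vertexOp (hV : IsClosedLocal V) (u v w : V) (c₁ c₂ b : Fin n → ℤ) (x : W) :
    (hV.vertexOp u c₁ (hV.vertexOp v c₂ w) : OpSeries n W) b x =
      nestedExp (fun a₁ a₂ b => u.1 a₁ (v.1 a₂ (w.1 b x))) c₁ c₂ b := by
  simp only [nestedExp, diagExp_map _ (hV.clearable v.2 w.2 x), ← hV.vertexOp_apply]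

lemma vertexOp_vertexOp_apply (hV : IsClosedLocal V) (u v w : V) (c₁ c₂ b : Fin n → ℤ) (x : W) :
    (hV.vertexOp (hV.vertexOp u c₁ v) c₂ w : OpSeries n W) b x =
      iterExp (fun a₁ a₂ b => u.1 a₁ (v.1 a₂ (w.1 b x))) c₁ c₂ b := by
  simp only [iterExp, ← hV.vertexOp_apply]

/-- Whichever of `u`, `v`, `w` acts first on `x` provides truncation in its variable, and the
cleared series equals those with `u` or `v` moved to that place. Further factors preserve
truncation. -/
lemma exists_lowerTruncated₃ (hV : IsClosedLocal V) (u v w : V) {L : List (Fin n)}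
    (hL : ∀ x, diffProd L (fun a b => u.1 a (v.1 b x)) = diffProd L fun a b => v.1 b (u.1 a x))
    (x : W) : ∃ L₁ L₂ : List (Fin n), LowerTruncated₃
      (diffProd₁₃ L₁ (diffProd₂₃ L₂ (diffProd₁₂ L fun a₁ a₂ b => u.1 a₁ (v.1 a₂ (w.1 b x))))) := by
  obtain ⟨L₁, h₁⟩ := mutuallyLocal_iff.1 (hV.mutuallyLocal u.2 w.2)
  obtain ⟨L₂, h₂⟩ := mutuallyLocal_iff.1 (hV.mutuallyLocal v.2 w.2)
  have stable {p : (Fin n → ℤ) → (Fin n → ℤ) → (Fin n → ℤ) → (Fin n → ℤ)}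
      (hp : ∀ a₁ a₂ b g₁ g₂ h, p (a₁ - g₁) (a₂ - g₂) (b - h) = p a₁ a₂ b - p g₁ g₂ h)
      {F : (Fin n → ℤ) → (Fin n → ℤ) → (Fin n → ℤ) → W} (hF : TruncatedAlong p F) :
      TruncatedAlong p (diffProd₁₃ L₁ (diffProd₂₃ L₂ (diffProd₁₂ L F))) :=
    .list_prod (fun _ _ h => h.shiftMul₃_sub hp _ _ _ _ _ _)
      (.list_prod (fun _ _ h => h.shiftMul₃_sub hp _ _ _ _ _ _)
        (.list_prod (fun _ _ h => h.shiftMul₃_sub hp _ _ _ _ _ _) hF L) L₂) L₁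
  refine ⟨L₁, L₂, .of_truncatedAlong ?_ ?_ ?_⟩
  · have e₁ : diffProd₁₂ L (fun a₁ a₂ b => u.1 a₁ (v.1 a₂ (w.1 b x))) =
        diffProd₁₂ L fun a₁ a₂ b => v.1 a₂ (u.1 a₁ (w.1 b x)) := by
      ext a₁ a₂ b
      rw [diffProd₁₂_apply, diffProd₁₂_apply, hL]
    have e₂ : diffProd₁₃ L₁ (fun a₁ a₂ b => v.1 a₂ (u.1 a₁ (w.1 b x))) =
        diffProd₁₃ L₁ fun a₁ a₂ b => v.1 a₂ (w.1 b (u.1 a₁ x)) := by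
      ext a₁ a₂ b
      rw [diffProd₁₃_apply, diffProd₁₃_apply, diffProd_map, diffProd_map, h₁]
    rw [e₁, diffProd₁₃_diffProd₂₃, ← diffProd₁₂_diffProd₁₃, e₂, diffProd₁₂_diffProd₁₃,
      ← diffProd₁₃_diffProd₂₃]
    refine stable (fun _ _ _ _ _ _ => rfl) ?_
    obtain ⟨N, hN⟩ := hV.mem_VO u.2 x
    refine ⟨N, fun a₁ a₂ b h => ?_⟩
    have : u.1 a₁ x = 0 := hN a₁ h
    simp [this]
  · have e : diffProd₂₃ L₂ (fun a₁ a₂ b => u.1 a₁ (v.1 a₂ (w.1 b x))) =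
        diffProd₂₃ L₂ fun a₁ a₂ b => u.1 a₁ (w.1 b (v.1 a₂ x)) := by
      ext a₁ a₂ b
      rw [diffProd₂₃_apply, diffProd₂₃_apply, diffProd_map, diffProd_map, h₂]
    rw [← diffProd₁₂_diffProd₂₃, e, diffProd₁₂_diffProd₂₃]
    refine stable (fun _ _ _ _ _ _ => rfl) ?_
    obtain ⟨N, hN⟩ := hV.mem_VO v.2 x
    refine ⟨N, fun a₁ a₂ b h => ?_⟩
    have : v.1 a₂ x = 0 := hN a₂ h
    simp [this]
  · refine stable (fun _ _ _ _ _ _ => rfl) ?_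
    obtain ⟨N, hN⟩ := hV.mem_VO w.2 x
    refine ⟨N, fun a₁ a₂ b h => ?_⟩
    have : w.1 b x = 0 := hN b h
    simp [this]

/-- The map that sends an element of `V` to the value at `x` of one of its coefficients. -/
def coeffMap (V : Submodule ℂ (OpSeries n W)) (b : Fin n → ℤ) (x : W) : V →ₗ[ℂ] W :=
  LinearMap.applyₗ x ∘ₗ LinearMap.proj b ∘ₗ V.subtype

/-- The list `L` that works for `u` and `v` also works for their vertex operators, since x₁ - x₂
becomes z₁ - z₂. -/
lemma mutuallyLocal_vertexOp (hV : IsClosedLocal V) (u v : V) :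
    MutuallyLocal (hV.vertexOp u) (hV.vertexOp v) := by
  obtain ⟨L, hL⟩ := mutuallyLocal_iff.1 (hV.mutuallyLocal u.2 v.2)
  refine mutuallyLocal_iff.2 ⟨L, fun w => ?_⟩
  ext c₁ c₂ b x
  change coeffMap V b x _ = coeffMap V b x _
  have h (g : (Fin n → ℤ) → (Fin n → ℤ) → V) : coeffMap V b x (diffProd L g c₁ c₂) =
      diffProd L (fun c₁ c₂ => coeffMap V b x (g c₁ c₂)) c₁ c₂ := by
    rw [diffProd_map]
  have h₁ : (fun c₁ c₂ => coeffMap V b x (hV.vertexOp u c₁ (hV.vertexOp v c₂ w))) =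
      fun c₁ c₂ => nestedExp (fun a₁ a₂ b => u.1 a₁ (v.1 a₂ (w.1 b x))) c₁ c₂ b := by
    ext c₁ c₂
    exact hV.vertexOp_vertexOp u v w c₁ c₂ b x
  have h₂ : (fun c₁ c₂ => coeffMap V b x (hV.vertexOp v c₂ (hV.vertexOp u c₁ w))) =
      fun c₁ c₂ => nestedExp (fun a₁ a₂ b => v.1 a₁ (u.1 a₂ (w.1 b x))) c₂ c₁ b := by
    ext c₁ c₂
    exact hV.vertexOp_vertexOp v u w c₂ c₁ b x
  obtain ⟨L₁, L₂, hL'⟩ := hV.exists_lowerTruncated₃ u v w hL x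
  rw [h, h, h₁, h₂]
  refine congrFun (congrFun (diffProd_nestedExp_swap hL' ?_ (hV.nestedClearable u v w x)
    (hV.nestedClearable v u w x) b) c₁) c₂
  ext a₁ a₂ b
  rw [diffProd₁₂_apply, diffProd₁₂_apply, hL]

lemma vertexOp_iterate (hV : IsClosedLocal V) (u v : V) (c b : Fin n → ℤ) (w : V) :
    hV.vertexOp (hV.vertexOp u c v) b w =
      diagExp (fun c₁ c₂ => hV.vertexOp u c₁ (hV.vertexOp v c₂ w)) c b := by
  obtain ⟨L, hL⟩ := mutuallyLocal_iff.1 (hV.mutuallyLocal u.2 v.2)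
  have hclear : Clearable fun c₁ c₂ => hV.vertexOp u c₁ (hV.vertexOp v c₂ w) :=
    (hV.mutuallyLocal_vertexOp u v).clearable (hV.vertexOp_mem_VO u) (hV.vertexOp_mem_VO v) w
  ext b' x
  obtain ⟨L₁, L₂, hL'⟩ := hV.exists_lowerTruncated₃ u v w hL x
  have h := (iterExp_eq_diagExp_nestedExp hL' (hV.nestedClearable u v w x)
    (hV.iterClearable u v w x) b').2 c b
  rw [hV.vertexOp_vertexOp_apply, h]
  change _ = coeffMap V b' x _
  -- The coefficient is read off inside the expansion; this requires clearing in `V` itself, known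
  -- from locality of the vertex operators.
  rw [← diagExp_map _ hclear]
  congr 1
  ext c₁ c₂
  exact (hV.vertexOp_vertexOp u v w c₁ c₂ b' x).symm

/-! ### The vacuum and the resulting structures -/

lemma nthProd_idOp_left {u : OpSeries n W} (hu : u ∈ VO n W) (c : Fin n → ℤ) :
    nthProd (-c - 1) (idOp n W) u = if c = 0 then u else 0 := by
  ext b w
  rw [nthProd_neg_apply (mutuallyLocal_idOp u).symm idOp_mem_VO hu, diagExp_eq_taylor, taylor,
    finsum_eq_single _ 0]
  · rw [idOp_apply, if_pos rfl, multiBinom_zero_left]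
    split_ifs with h
    · simp [h]
    · simp
  · intro a ha
    rw [idOp_apply, if_neg ha, smul_zero]
  · rw [lowerTruncated₂_iff]
    refine ⟨?_, truncatedRight_of_mem_VO hu _ w⟩
    have := truncatedLeft_of_mem_VO (idOp_mem_VO (n := n) (W := W)) u w
    have e : (fun a b => idOp n W a (u b w)) = fun a b => u b (idOp n W a w) := by
      ext a b
      simp only [idOp_apply]
      split_ifs <;> simp
    rwa [e]

/-- The product of u(x) and 1 is u(x), so Y(u, z)1 is the Taylor series u(y + z): no negative powers
of z, constant term u. -/
lemma nthProd_idOp_right {u : OpSeries n W} (hu : u ∈ VO n W) (c b : Fin n → ℤ) :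
    nthProd (-c - 1) u (idOp n W) b = multiBinom (b + c) c • u (b + c) := by
  ext w
  rw [nthProd_neg_apply (mutuallyLocal_idOp u) hu idOp_mem_VO, diagExp_eq_taylor, taylor,
    finsum_eq_single _ (b + c)]
  · rw [idOp_apply, if_pos (sub_self _), LinearMap.smul_apply]
  · intro a ha
    rw [idOp_apply, if_neg (sub_ne_zero.2 ha.symm), map_zero, smul_zero]
  · rw [lowerTruncated₂_iff]
    refine ⟨?_, truncatedRight_of_mem_VO idOp_mem_VO _ w⟩
    have := truncatedLeft_of_mem_VO hu (idOp n W) w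
    have e : (fun a b => u a (idOp n W b w)) = fun a b => idOp n W b (u a w) := by
      ext a b
      simp only [idOp_apply]
      split_ifs <;> simp
    rwa [e]

/-- The vertex algebra structure on a closed local subspace that contains `1`. -/
noncomputable def vertexAlgebra (hV : IsClosedLocal V) (h1 : idOp n W ∈ V) :
    GnVertexAlgebra n V where
  Y := hV.vertexOp
  vac := ⟨idOp n W, h1⟩
  truncated := hV.vertexOp_mem_VO
  Y_vac := by
    ext c v : 2
    refine Subtype.ext ?_
    rw [hV.coe_vertexOp, idOp_apply]
    exact (nthProd_idOp_left (hV.mem_VO v.2) c).trans (by split_ifs <;> rfl)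
  creation_regular v c := by
    rintro ⟨i, hi⟩
    ext b : 2
    rw [hV.coe_vertexOp]
    exact (nthProd_idOp_right (hV.mem_VO v.2) c b).trans
      (by rw [multiBinom_of_neg _ hi, zero_smul]; rfl)
  creation_limit v := by
    ext b : 2
    rw [hV.coe_vertexOp]
    exact (nthProd_idOp_right (hV.mem_VO v.2) 0 b).trans
      (by rw [multiBinom_zero_right, one_smul, add_zero])
  weak_commutativity := hV.mutuallyLocal_vertexOp
  jacobi := jacobiIdentity_of_apply_apply hV.vertexOp_mem_VO hV.mutuallyLocal_vertexOp
    hV.vertexOp_iterate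

/-- The action on `W` of a closed local subspace that contains `1`. -/
noncomputable def gnModule (hV : IsClosedLocal V) (h1 : idOp n W ∈ V) :
    GnModule (hV.vertexAlgebra h1) W where
  YW := V.subtype
  truncated u := hV.mem_VO u.2
  Y_vac := rfl
  weak_commutativity u v := hV.mutuallyLocal u.2 v.2
  -- On W the iterate form is the description of the m-th products by diagonal expansions.
  jacobi := jacobiIdentity_of_apply_apply (fun u => hV.mem_VO u.2)
    (fun u v => hV.mutuallyLocal u.2 v.2) hV.vertexOp_apply

end IsClosedLocal

end

/-- A set `S` of pairwise mutually local `Gₙ`-vertex operators on `W` generates a canonical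
`Gₙ`-vertex algebra `⟨S⟩`, the smallest closed local subspace that contains `S` and `1`, with
vertex operators `Y(ψ, z) φ = ∑_m (ψ_m φ) z ^ (-m - 1)` and vacuum `1`, and `W` is a module for it
through `Y_W(ψ, x) = ψ(x)`. -/
theorem theorem4p18 (n : ℕ) (hn : 0 < n) (W : Type*) [AddCommGroup W] [Module ℂ W]
    (S : Set (OpSeries n W)) (hS : IsLocalSet S) :
    IsLeast {V : Submodule ℂ (OpSeries n W) | IsClosedLocal V ∧ S ⊆ V ∧ idOp n W ∈ V}
        (generatedBy S) ∧
      ∃ A : GnVertexAlgebra n (generatedBy S),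
        (A.vac : OpSeries n W) = idOp n W ∧
        (∀ (ψ φ : generatedBy S) (m : Fin n → ℤ),
          (A.Y ψ (fun i => -m i - 1) φ : OpSeries n W) = nthProd m ψ φ) ∧
        ∃ M : GnModule A W, ∀ ψ : generatedBy S, M.YW ψ = (ψ : OpSeries n W) := by
  obtain ⟨hmem, hle⟩ := isLeast_generatedBy hS
  refine ⟨⟨hmem, hle⟩, hmem.1.vertexAlgebra hmem.2.2, rfl, fun ψ φ m => ?_,
    hmem.1.gnModule hmem.2.2, fun ψ => rfl⟩
  have hm : -(fun i => -m i - 1) - (1 : Fin n → ℤ) = m := by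
    ext i
    simp
  exact (hmem.1.coe_vertexOp ψ φ fun i => -m i - 1).trans (by rw [hm])
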